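/- Let $n\ge 2$ and label the computational basis of $n$ qubits by subsets $S\subseteq\{1,\dots,n\}$ (the qubits in state $1$), the Hamming weight of $|S\rangle$ being $k=|S|$. Identify $|S\rangle$ with $\bigwedge_{i\in S}e_i$ (factors in increasing order), and let $\phi$ be the unitary representation of $\mathrm{SU}(n)$ on $(\mathbb C^2)^{\otimes n}\cong\bigoplus_{k=0}^{n}\bigwedge^k\mathbb C^n$ given by the direct sum of the exterior powers, with differential $d\phi$ on $\mathfrak{su}(n)$. The generators of the $\mathrm{SU}(n)$ quantum compound ansatz are, for $i<j$, $$h_x^{ij}=-\tfrac i4(\sigma_x^i\sigma_x^j+\sigma_y^i\sigma_y^j)\prod_{i<q<j}\sigma_z^q,\quad h_y^{ij}=-\tfrac i4(\sigma_y^i\sigma_x^j-\sigma_x^i\sigma_y^j)\prod_{i<q<j}\sigma_z^q,\quad h_z^{ij}=-\tfrac i4(\sigma_z^i-\sigma_z^j).$$ Their dynamical Lie algebra (the real Lie algebra they generate) is denoted $\mathfrak g$; the ansatz with Hermitian observable $O$ is a Lie algebra supported ansatz (LASA) if $iO\in\mathfrak g$. For a state $\rho$, an observable $O$ and a skew-Hermitian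 operator $H$ put $$\mathrm{GradVar}=\mathrm{Var}_{(g^+,g^-)\sim\mu^{\otimes2}}\Big[\mathrm{Tr}\big\{\phi(g^-)^\dagger\rho\,\phi(g^-)\,[H,\phi(g^+)O\phi(g^+)^\dagger]\big\}\Big],$$ where $\mu$ is the Haar probability measure of $\mathrm{SU}(n)$. Write $\|a\|^2=-\mathrm{Tr}(a^2)$ for $a\in\mathfrak{su}(n)$. Take $\rho=|S\rangle\langle S|$, $k=|S|$. Then: 1. $\mathfrak g=d\phi(\mathfrak{su}(n))$, and the ansatz with observable $i h_z^{12}$ is a LASA. 2. If $iO=d\phi(o)$ and $H=d\phi(h)$ with $o,h\in\mathfrak{su}(n)$, then $\mathrm{GradVar}=\dfrac{2\|o\|^2\|h\|^2\,k(n-k)}{(n^2-1)^2}$. 3. In particular, for $O=i h_z^{12}$ and $H$ any of the generators, $\mathrm{GradVar}=\dfrac{k(n-k)}{2(n^2-1)^2}$. 4. For $O=i h_z^{12}$ there is a constant $c>0$ such that $\mathrm{GradVar}\ge c/n^3$ for all $n\ge2$, all generators $H$ and all $S$ with $1\le k\le n-1$. 5. Hence, for every choice, for each $n\ge 2$, of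 a basis state of weight $1\le k_n\le n-1$ and a generator $H_n$, with $O_n=i h_z^{12}$ — and, more generally, of $O_n=-i\,d\phi(o_n)$ and $H_n=d\phi(h_n)$ with $o_n,h_n\in\mathfrak{su}(n)$ and $\|o_n\|^2,\|h_n\|^2$ bounded below by a positive constant — $\mathrm{GradVar}\in\Omega(1/n^3)$, and there is no barren plateau: $\mathrm{GradVar}\notin\mathcal O(b^{-n})$ for every $b>1$. -/

import Mathlib

open Matrix Complex MeasureTheory ProbabilityTheory Asymptotics Filter

noncomputable section

namespace Compound

/-! ## Qubits and Pauli operators -/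

/-- Operators on `n` qubits, as matrices in the computational basis. The basis state `|S⟩` is
labelled by the set `S` of those qubits that are in state `1`; its Hamming weight is `S.card`. -/
abbrev Op (n : ℕ) := Matrix (Finset (Fin n)) (Finset (Fin n)) ℂ

/-- The bit of qubit `q` in the basis state `|S⟩`. -/
def bit {n : ℕ} (S : Finset (Fin n)) (q : Fin n) : Fin 2 := if q ∈ S then 1 else 0

def pauliX : Matrix (Fin 2) (Fin 2) ℂ := !![0, 1; 1, 0]
def pauliY : Matrix (Fin 2) (Fin 2) ℂ := !![0, -I; I, 0]
def pauliZ : Matrix (Fin 2) (Fin 2) ℂ := !![1, 0; 0, -1]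

/-- The tensor product `⨂ q, A q` of one-qubit operators. -/
def tensorOp {n : ℕ} (A : Fin n → Matrix (Fin 2) (Fin 2) ℂ) : Op n :=
  Matrix.of fun S T => ∏ q, A q (bit S q) (bit T q)

/-- The one-qubit operator `A` acting on qubit `i`. -/
def onQubit {n : ℕ} (i : Fin n) (A : Matrix (Fin 2) (Fin 2) ℂ) : Op n :=
  tensorOp fun q => if q = i then A else 1

/-- `A` on qubit `i`, `B` on qubit `j`, and `σ_z` on each qubit strictly between `i` and `j`. -/
def stringOp {n : ℕ} (i j : Fin n) (A B : Matrix (Fin 2) (Fin 2) ℂ) : Op n :=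
  tensorOp fun q => if q = i then A else if q = j then B
    else if i < q ∧ q < j then pauliZ else 1

/-- `h_x^{ij} = -(i/4) (σ_x^i σ_x^j + σ_y^i σ_y^j) ⊗ (σ_z's between)`, used for `i < j`. -/
def hx {n : ℕ} (i j : Fin n) : Op n :=
  (-(I / 4)) • (stringOp i j pauliX pauliX + stringOp i j pauliY pauliY)

/-- `h_y^{ij} = -(i/4) (σ_y^i σ_x^j - σ_x^i σ_y^j) ⊗ (σ_z's between)`, used for `i < j`. -/
def hy {n : ℕ} (i j : Fin n) : Op n :=
  (-(I / 4)) • (stringOp i j pauliY pauliX - stringOp i j pauliX pauliY)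

/-- `h_z^{ij} = -(i/4) (σ_z^i - σ_z^j)`. -/
def hz {n : ℕ} (i j : Fin n) : Op n :=
  (-(I / 4)) • (onQubit i pauliZ - onQubit j pauliZ)

/-- The skew-Hermitian generators of the `SU(n)` quantum compound ansatz. -/
def generators (n : ℕ) : Set (Op n) :=
  {H | ∃ i j : Fin n, i < j ∧ (H = hx i j ∨ H = hy i j ∨ H = hz i j)}

attribute [local instance 100] LieRing.ofAssociativeRing

/-- The dynamical Lie algebra: the real Lie algebra generated by a set of operators. -/
def dla {n : ℕ} (gens : Set (Op n)) : LieSubalgebra ℝ (Op n) :=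
  LieSubalgebra.lieSpan ℝ (Op n) gens

/-- The ansatz with skew-Hermitian generators `gens` and Hermitian observable `O` is Lie algebra
supported: `i O` belongs to the dynamical Lie algebra. -/
def IsLASA {n : ℕ} (gens : Set (Op n)) (O : Op n) : Prop :=
  O.IsHermitian ∧ I • O ∈ dla gens

/-- The density matrix `|S⟩⟨S|`. -/
def basisState {n : ℕ} (S : Finset (Fin n)) : Op n := Matrix.single S S 1

/-! ## The group `SU(n)`, its Haar measure, its Lie algebra -/

abbrev SU (n : ℕ) := Matrix.specialUnitaryGroup (Fin n) ℂ

instance (n : ℕ) : IsTopologicalGroup (SU n) where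
  continuous_inv := by
    refine Continuous.subtype_mk (f := fun A : SU n => star (A : Matrix (Fin n) (Fin n) ℂ)) ?_ _
    exact continuous_star.comp continuous_subtype_val

instance (n : ℕ) : CompactSpace (SU n) := by
  refine (isCompact_iff_compactSpace (s := (Matrix.specialUnitaryGroup (Fin n) ℂ :
    Set (Matrix (Fin n) (Fin n) ℂ)))).mp ?_
  have hK : IsCompact (Set.pi Set.univ fun _ : Fin n => Set.pi Set.univ fun _ : Fin n =>
      Metric.closedBall (0 : ℂ) 1) :=
    isCompact_univ_pi fun _ => isCompact_univ_pi fun _ => isCompact_closedBall _ _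
  refine IsCompact.of_isClosed_subset (X := Matrix (Fin n) (Fin n) ℂ) hK ?_ ?_
  · have h : (Matrix.specialUnitaryGroup (Fin n) ℂ : Set (Matrix (Fin n) (Fin n) ℂ)) =
        {A | A * star A = 1} ∩ {A | A.det = 1} := by
      ext A
      simp [Matrix.mem_specialUnitaryGroup_iff, Matrix.mem_unitaryGroup_iff]
    rw [h]
    exact (isClosed_eq (by fun_prop) continuous_const).inter
      (isClosed_eq (by fun_prop) continuous_const)
  · intro A hA i _ j _
    rw [mem_closedBall_zero_iff]
    exact entry_norm_bound_of_unitary (Matrix.specialUnitaryGroup_le_unitaryGroup hA) i j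

instance (n : ℕ) : MeasurableSpace (SU n) := borel _
instance (n : ℕ) : BorelSpace (SU n) := ⟨rfl⟩

/-- The Haar probability measure of `SU(n)`. -/
def haarSU (n : ℕ) : Measure (SU n) := Measure.haarMeasure ⊤

/-- The Lie algebra `𝔰𝔲(n)`: traceless skew-Hermitian matrices. -/
def su (n : ℕ) : Set (Matrix (Fin n) (Fin n) ℂ) := {a | aᴴ = -a ∧ a.trace = 0}

/-- The standard norm squared, `‖a‖² = -Tr(a²)` (a nonnegative real for `a ∈ 𝔰𝔲(n)`). -/
def stdNormSq {n : ℕ} (a : Matrix (Fin n) (Fin n) ℂ) : ℝ := (-(a * a).trace).re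

/-! ## The compound representation -/

/-- The map that `g` induces on the exterior algebra `⨁ₖ ⋀ᵏ ℂⁿ`, as an operator on `n` qubits: the
basis state `|S⟩` is identified with the exterior product, in increasing order, of the standard
basis vectors `e_i`, `i ∈ S`. -/
def compound {n : ℕ} (g : Matrix (Fin n) (Fin n) ℂ) : Op n :=
  LinearMap.toMatrix (Pi.basisFun ℂ (Fin n)).ExteriorAlgebra (Pi.basisFun ℂ (Fin n)).ExteriorAlgebra
    (ExteriorAlgebra.map (Matrix.toLin' g)).toLinearMap

/-- The representation `φ` of `SU(n)` on `n` qubits: the direct sum of the exterior powers. -/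
def phi {n : ℕ} : SU n →* Op n where
  toFun g := compound g
  map_one' := by
    simp [compound, Matrix.toLin'_one, ExteriorAlgebra.map_id]
  map_mul' g h := by
    simp only [compound, Submonoid.coe_mul, Matrix.toLin'_mul, ← ExteriorAlgebra.map_comp_map]
    rw [← LinearMap.toMatrix_comp]
    rfl

/-- The differential `dφ(a) = d/dt φ(exp(t a))` at `t = 0`. -/
def dphi {n : ℕ} (a : Matrix (Fin n) (Fin n) ℂ) : Op n :=
  Matrix.of fun S T => deriv (fun t : ℝ => compound (NormedSpace.exp (t • a)) S T) 0

/-! ## The abstracted gradient and its variance -/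

/-- The abstracted gradient `Tr(U₋† ρ U₋ [H, U₊ O U₊†])` with `U₊ = φ(g₊)`, `U₋ = φ(g₋)`. -/
def absGrad {n : ℕ} (ρ O H : Op n) (gp gm : SU n) : ℂ :=
  ((phi gm)ᴴ * ρ * phi gm *
    (H * (phi gp * O * (phi gp)ᴴ) - (phi gp * O * (phi gp)ᴴ) * H)).trace

/-- For Hermitian `ρ`, `O` and skew-Hermitian `H` the abstracted gradient is real. -/
theorem absGrad_im {n : ℕ} {ρ O H : Op n} (hρ : ρᴴ = ρ) (hO : Oᴴ = O) (hH : Hᴴ = -H)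
    (gp gm : SU n) : (absGrad ρ O H gp gm).im = 0 := by
  have key : ∀ A P : Op n, Aᴴ = A → Pᴴ = P → ((P * (H * A - A * H)).trace).im = 0 := by
    intro A P hA hP
    rw [← Complex.conj_eq_iff_im, starRingEnd_apply, ← Matrix.trace_conjTranspose,
      Matrix.conjTranspose_mul, Matrix.trace_mul_comm, Matrix.conjTranspose_sub,
      Matrix.conjTranspose_mul, Matrix.conjTranspose_mul, hA, hP, hH, Matrix.mul_neg,
      Matrix.neg_mul, sub_neg_eq_add, neg_add_eq_sub]
  refine key _ _ ?_ ?_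
  · rw [Matrix.conjTranspose_mul, Matrix.conjTranspose_mul, Matrix.conjTranspose_conjTranspose, hO,
      Matrix.mul_assoc]
  · rw [Matrix.conjTranspose_mul, Matrix.conjTranspose_mul, Matrix.conjTranspose_conjTranspose, hρ,
      Matrix.mul_assoc]

/-- The variance of the abstracted gradient (a real number, by `absGrad_im`) for independent
Haar distributed `g₊`, `g₋`. -/
def gradVar {n : ℕ} (ρ O H : Op n) : ℝ :=
  Var[fun p : SU n × SU n => (absGrad ρ O H p.1 p.2).re; (haarSU n).prod (haarSU n)]

end Compound

end

noncomputable section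

namespace Compound

attribute [local instance 100] LieRing.ofAssociativeRing

variable {n : ℕ}

/-! ## Tensor products of one-qubit operators -/

/-! Under the Jordan–Wigner correspondence, left exterior multiplication by `e_i` is the creation
operator `c_i†` (`toMatrix_mulLeft_extE`), so statements about operators of size `2^n` reduce to the
canonical anticommutation relations. The compound matrix `Λg` is determined by fixing the vacuum and
by `Λg c_j† = (∑ g_ij c_i†) Λg` (`compound_mul_creation`, `eq_of_mul_creation_eq`). This gives its
unitarity, the formula `dφ(a) = ∑ a_ij c_i† c_j` (`dphi_eq_dGamma`) and the covariance
`compound_conj_dGamma`. The generators become elementary `n × n` skew-Hermitian matrices of norm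
squared `1/2` whose real span is `𝔰𝔲(n)`; this identifies the dynamical Lie algebra.

By `dGamma_commutator` and `dGamma_diag` the abstracted gradient collapses to `-i Tr(P_S g₋ [h, g₊ o
g₊†] g₋†)`, an `n × n` quantity (`absGrad_eq`). Its variance needs only the first two Haar moments
of the adjoint orbit of a traceless `y`. An invariant bilinear form on `𝔤𝔩(n)` is `α Tr X Tr Y + β
Tr XY` (`eq_trace_of_commutator_invariant`), so the second moment is `Tr(y²)/(n²-1) · (Tr XY - Tr X
Tr Y / n)`. Averaging over `g₋` with `X = Y = P_S` gives the factor `k(n-k)/n`. Averaging `Tr [h, g₊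
o g₊†]²` over `g₊` gives the Casimir factor `2n` and a second `1/(n²-1)`. Finally `k(n-k) ≥ n-1` for
`1 ≤ k ≤ n-1` yields the order `1/n³`. -/

theorem bit_eq_bit_iff (S T : Finset (Fin n)) (q : Fin n) :
    bit S q = bit T q ↔ (q ∈ S ↔ q ∈ T) := by
  unfold bit
  split_ifs <;> simp_all

/-- Basis states correspond to functions from qubits to bits. -/
def bitEquiv (n : ℕ) : Finset (Fin n) ≃ (Fin n → Fin 2) where
  toFun S := bit S
  invFun f := Finset.univ.filter fun q => f q = 1
  left_inv S := by
    ext q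
    simp [bit]
  right_inv f := by
    funext q
    simp only [bit, Finset.mem_filter, Finset.mem_univ, true_and]
    split_ifs with h
    · exact h.symm
    · omega

theorem tensorOp_mul (A B : Fin n → Matrix (Fin 2) (Fin 2) ℂ) :
    tensorOp A * tensorOp B = tensorOp fun q => A q * B q := by
  ext S T
  simp only [tensorOp, Matrix.mul_apply, Matrix.of_apply, ← Finset.prod_mul_distrib]
  have h := (bitEquiv n).sum_comp (fun f => ∏ q, A q (bit S q) (f q) * B q (f q) (bit T q))
  refine h.trans ?_
  rw [Finset.prod_univ_sum]
  simp [Fintype.piFinset_univ]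

theorem tensorOp_one : tensorOp (fun _ : Fin n => (1 : Matrix (Fin 2) (Fin 2) ℂ)) = 1 := by
  ext S T
  simp only [tensorOp, Matrix.of_apply, Matrix.one_apply]
  rw [Finset.prod_ite_zero]
  simp only [Finset.mem_univ, true_implies, Finset.prod_const_one, bit_eq_bit_iff, Finset.ext_iff]

theorem tensorOp_conjTranspose (A : Fin n → Matrix (Fin 2) (Fin 2) ℂ) :
    (tensorOp A)ᴴ = tensorOp fun q => (A q)ᴴ := by
  ext S T
  simp [tensorOp, Matrix.conjTranspose_apply]

theorem tensorOp_update_apply (F : Fin n → Matrix (Fin 2) (Fin 2) ℂ) (i : Fin n)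
    (A : Matrix (Fin 2) (Fin 2) ℂ) (S T : Finset (Fin n)) :
    tensorOp (Function.update F i A) S T =
      A (bit S i) (bit T i) * ∏ q ∈ Finset.univ.erase i, F q (bit S q) (bit T q) := by
  simp only [tensorOp, Matrix.of_apply]
  rw [← Finset.mul_prod_erase _ _ (Finset.mem_univ i)]
  congr 1
  · simp
  · refine Finset.prod_congr rfl fun q hq => ?_
    rw [Function.update_of_ne (Finset.ne_of_mem_erase hq)]

theorem tensorOp_update_add (F : Fin n → Matrix (Fin 2) (Fin 2) ℂ) (i : Fin n)
    (A B : Matrix (Fin 2) (Fin 2) ℂ) :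
    tensorOp (Function.update F i (A + B)) =
      tensorOp (Function.update F i A) + tensorOp (Function.update F i B) := by
  ext S T
  simp [tensorOp_update_apply, add_mul]

theorem tensorOp_update_smul (F : Fin n → Matrix (Fin 2) (Fin 2) ℂ) (i : Fin n) (c : ℂ)
    (A : Matrix (Fin 2) (Fin 2) ℂ) :
    tensorOp (Function.update F i (c • A)) = c • tensorOp (Function.update F i A) := by
  ext S T
  simp [tensorOp_update_apply, mul_assoc]

/-! ## Fermionic creation operators -/

/-- The one-qubit operator `|1⟩⟨0|`. -/
def raising : Matrix (Fin 2) (Fin 2) ℂ := !![0, 0; 1, 0]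

/-- The one-qubit operator `|0⟩⟨1|`. -/
def lowering : Matrix (Fin 2) (Fin 2) ℂ := !![0, 1; 0, 0]

/-- The Jordan-Wigner creation operator on qubit `i`. -/
def creation (i : Fin n) : Op n :=
  tensorOp fun q => if q < i then pauliZ else if q = i then raising else 1

/-- The sign `(-1) ^ #{q ∈ T | q < i}`. -/
def jwSign (i : Fin n) (T : Finset (Fin n)) : ℂ := (-1) ^ (T.filter (· < i)).card

/-- A nonzero product forces every tensor factor to be nonzero: the factors away from `i` are
diagonal, so the bits agree there, and `raising` forces `0 → 1` at `i`. The sign collects the `σ_z`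
factors on the occupied qubits below `i`. -/
theorem creation_apply (i : Fin n) (S T : Finset (Fin n)) :
    creation i S T = if i ∉ T ∧ S = insert i T then jwSign i T else 0 := by
  simp only [creation, tensorOp, Matrix.of_apply]
  split_ifs with h
  · obtain ⟨hi, rfl⟩ := h
    rw [jwSign, ← Finset.prod_const, Finset.prod_filter]
    rw [← Finset.prod_subset_one_on_sdiff (Finset.subset_univ T) (fun q hq => ?_) fun q hq => ?_]
    · rcases lt_trichotomy q i with hqi | hqi | hqi
      · have := (Finset.mem_sdiff.1 hq).2
        simp [hqi, bit, this, hqi.ne, pauliZ]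
      · subst hqi; simp [bit, hi, raising]
      · rw [if_neg hqi.not_gt, if_neg hqi.ne', Matrix.one_apply, if_pos]
        simp [bit, hqi.ne']
    · have hqi : q ≠ i := fun h => hi (h ▸ hq)
      by_cases hlt : q < i
      · simp [hlt, bit, hq, pauliZ]
      · rw [if_neg hlt, if_neg hlt, if_neg hqi, Matrix.one_apply, if_pos]
        simp [bit, hq]
  · by_contra hne
    refine h ?_
    have hall : ∀ q, (if q < i then pauliZ else if q = i then raising else 1) (bit S q) (bit T q)
        ≠ 0 := fun q h0 => hne (Finset.prod_eq_zero (Finset.mem_univ q) h0)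
    have hi := hall i
    have hoff : ∀ q, q ≠ i → (q ∈ S ↔ q ∈ T) := by
      intro q hq
      have := hall q
      simp only [hq, if_false] at this
      unfold bit at this
      by_cases h1 : q ∈ S <;> by_cases h2 : q ∈ T <;> by_cases h3 : q < i <;>
        simp_all [pauliZ]
    have hi2 : i ∈ S ∧ i ∉ T := by
      simp only [lt_irrefl, if_false, if_true] at hi
      unfold bit at hi
      by_cases h1 : i ∈ S <;> by_cases h2 : i ∈ T <;> simp_all [raising]
    refine ⟨hi2.2, ?_⟩
    ext q
    by_cases hq : q = i
    · subst hq; simp [hi2.1]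
    · simp [hq, hoff q hq]

theorem raising_conjTranspose : raisingᴴ = lowering := by
  ext i j; fin_cases i <;> fin_cases j <;> simp [raising, lowering]

theorem pauliZ_conjTranspose : pauliZᴴ = pauliZ := by
  ext i j; fin_cases i <;> fin_cases j <;> simp [pauliZ]

theorem pauliZ_mul_pauliZ : pauliZ * pauliZ = 1 := by
  ext i j; fin_cases i <;> fin_cases j <;> simp [pauliZ]

theorem lowering_mul_pauliZ : lowering * pauliZ = -lowering := by
  ext i j; fin_cases i <;> fin_cases j <;> simp [pauliZ, lowering]

theorem pauliZ_mul_lowering : pauliZ * lowering = lowering := by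
  ext i j; fin_cases i <;> fin_cases j <;> simp [pauliZ, lowering]

theorem raising_mul_pauliZ : raising * pauliZ = raising := by
  ext i j; fin_cases i <;> fin_cases j <;> simp [pauliZ, raising]

theorem lowering_mul_raising_add : lowering * raising + raising * lowering = 1 := by
  ext i j; fin_cases i <;> fin_cases j <;> simp [raising, lowering]

theorem creation_conjTranspose (i : Fin n) :
    (creation i)ᴴ = tensorOp fun q => if q < i then pauliZ else if q = i then lowering else 1 := by
  rw [creation, tensorOp_conjTranspose]
  congr 1
  funext q
  split_ifs <;> simp [raising_conjTranspose, pauliZ_conjTranspose]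

theorem annihilation_creation_self (i : Fin n) :
    (creation i)ᴴ * creation i + creation i * (creation i)ᴴ = 1 := by
  rw [creation_conjTranspose, creation, tensorOp_mul, tensorOp_mul]
  have h1 : ∀ A B : Matrix (Fin 2) (Fin 2) ℂ, (fun q : Fin n =>
      (if q < i then pauliZ else if q = i then A else 1) *
      (if q < i then pauliZ else if q = i then B else 1)) =
      Function.update (fun _ => 1) i (A * B) := by
    intro A B
    funext q
    rcases lt_trichotomy q i with h | h | h
    · simp [h, h.ne, pauliZ_mul_pauliZ]
    · subst h; simp
    · simp [h.not_gt, h.ne']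
  rw [h1, h1, ← tensorOp_update_add, lowering_mul_raising_add, Function.update_eq_self_iff.2 rfl,
    tensorOp_one]

/-- The two products differ only at site `i`, where the `σ_z` from the string of `j` meets
`lowering`; these anticommute, which is the sole source of the minus sign. -/
theorem annihilation_creation_of_lt {i j : Fin n} (hij : i < j) :
    (creation i)ᴴ * creation j + creation j * (creation i)ᴴ = 0 := by
  rw [creation_conjTranspose, creation, tensorOp_mul, tensorOp_mul]
  set F : Fin n → Matrix (Fin 2) (Fin 2) ℂ := fun q =>
    if q < i then 1 else if q < j then pauliZ else if q = j then raising else 1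
  have h1 : (fun q : Fin n => (if q < i then pauliZ else if q = i then lowering else 1) *
      (if q < j then pauliZ else if q = j then raising else 1)) =
      Function.update F i ((-1 : ℂ) • lowering) := by
    funext q
    rcases lt_trichotomy q i with h | h | h
    · simp [F, h, h.ne, h.trans hij, pauliZ_mul_pauliZ]
    · subst h; simp [hij, lowering_mul_pauliZ]
    · simp [F, h.not_gt, h.ne']
  have h2 : (fun q : Fin n => (if q < j then pauliZ else if q = j then raising else 1) *
      (if q < i then pauliZ else if q = i then lowering else 1)) =
      Function.update F i lowering := by
    funext q
    rcases lt_trichotomy q i with h | h | h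
    · simp [F, h, h.ne, h.trans hij, pauliZ_mul_pauliZ]
    · subst h; simp [hij, pauliZ_mul_lowering]
    · simp [F, h.not_gt, h.ne']
  rw [h1, h2, tensorOp_update_smul]
  simp

theorem annihilation_creation (i j : Fin n) :
    (creation i)ᴴ * creation j + creation j * (creation i)ᴴ = if i = j then 1 else 0 := by
  rcases lt_trichotomy i j with h | h | h
  · rw [annihilation_creation_of_lt h, if_neg h.ne]
  · subst h
    rw [annihilation_creation_self, if_pos rfl]
  · have := congrArg Matrix.conjTranspose (annihilation_creation_of_lt h)
    simpa [h.ne', Matrix.conjTranspose_add, Matrix.conjTranspose_mul] using this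

/-! ## The exterior algebra basis and left multiplication -/

/-- The basis of the exterior algebra of `ℂⁿ` that corresponds to the computational basis. -/
abbrev extBasis (n : ℕ) : Module.Basis (Finset (Fin n)) ℂ (ExteriorAlgebra ℂ (Fin n → ℂ)) :=
  (Pi.basisFun ℂ (Fin n)).ExteriorAlgebra

/-- The standard basis vector `e_i` in the exterior algebra. -/
abbrev extE (i : Fin n) : ExteriorAlgebra ℂ (Fin n → ℂ) :=
  ExteriorAlgebra.ι ℂ (Pi.single i 1 : Fin n → ℂ)

theorem extBasis_eq_prod (S : Finset (Fin n)) : extBasis n S = (S.sort.map extE).prod := by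
  rw [ExteriorAlgebra.basis_apply_ofCard _ rfl, ExteriorAlgebra.ιMulti_family,
    ExteriorAlgebra.ιMulti_apply, ← Finset.listMap_orderEmbOfFin_finRange S rfl, List.map_map, List.ofFn_eq_map]
  congr 2
  funext i
  simp only [Function.comp, Pi.basisFun_apply, extE]
  rfl

theorem extBasis_empty : extBasis n ∅ = 1 := by
  rw [extBasis_eq_prod, Finset.sort_empty]
  rfl

theorem extE_mul_extBasis_of_lt {m : Fin n} {T : Finset (Fin n)} (h : ∀ q ∈ T, m < q) :
    extE m * extBasis n T = extBasis n (insert m T) := by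
  rw [extBasis_eq_prod, extBasis_eq_prod,
    Finset.sort_insert _ (fun q hq => (h q hq).le) (fun hm => (h m hm).false)]
  simp

theorem extE_mul_extE (i j : Fin n) : extE i * extE j = -(extE j * extE i) :=
  eq_neg_of_add_eq_zero_left (ExteriorAlgebra.ι_add_mul_swap _ _)

/-- Moving `e_j` into its ordered place past each smaller factor costs one sign. Splitting off the
minimum of the set moves it past one factor at a time. -/
theorem extE_mul_extBasis (T : Finset (Fin n)) : ∀ j : Fin n,
    extE j * extBasis n T = if j ∈ T then 0 else jwSign j T • extBasis n (insert j T) := by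
  induction T using Finset.induction_on_min with
  | empty =>
    intro j
    rw [extE_mul_extBasis_of_lt (by simp)]
    simp [jwSign]
  | insert m T hm ih =>
    intro j
    have hmT : m ∉ T := fun h => (hm m h).false
    rw [← extE_mul_extBasis_of_lt hm]
    rcases lt_trichotomy j m with hj | hj | hj
    · have hlt : ∀ q ∈ insert m T, j < q := by
        intro q hq
        rcases Finset.mem_insert.1 hq with rfl | hq
        exacts [hj, hj.trans (hm q hq)]
      rw [extE_mul_extBasis_of_lt hm, extE_mul_extBasis_of_lt hlt,
        if_neg fun h => (hlt j h).false, jwSign,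
        Finset.filter_eq_empty_iff.2 fun q hq => (hlt q hq).not_gt]
      simp
    · subst hj
      rw [← mul_assoc, ExteriorAlgebra.ι_sq_zero, zero_mul, if_pos (Finset.mem_insert_self _ _)]
    · rw [← mul_assoc, extE_mul_extE, neg_mul, mul_assoc, ih j]
      by_cases hjT : j ∈ T
      · simp [hjT]
      · have hlt : ∀ q ∈ insert j T, m < q := by
          intro q hq
          rcases Finset.mem_insert.1 hq with rfl | hq
          exacts [hj, hm q hq]
        rw [if_neg hjT, if_neg (by simp [hjT, hj.ne']), mul_smul_comm,
          extE_mul_extBasis_of_lt hlt, Finset.insert_comm, jwSign, jwSign,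
          Finset.filter_insert, if_pos hj, Finset.card_insert_of_notMem (by simp [hmT]), pow_succ]
        simp

/-- The bridge between the two pictures: the Jordan–Wigner string is the sign produced by sorting a
wedge product. -/
theorem toMatrix_mulLeft_extE (j : Fin n) :
    LinearMap.toMatrix (extBasis n) (extBasis n) (LinearMap.mulLeft ℂ (extE j)) = creation j := by
  ext S T
  rw [LinearMap.toMatrix_apply, LinearMap.mulLeft_apply, extE_mul_extBasis, creation_apply]
  by_cases hj : j ∈ T
  · simp [hj]
  · simp only [hj, if_false, map_smul, Module.Basis.repr_self, Finsupp.smul_apply,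
      Finsupp.single_apply, not_false_iff, true_and, smul_eq_mul, eq_comm (a := S)]
    simp

theorem creation_mul_creation (i j : Fin n) :
    creation i * creation j = -(creation j * creation i) := by
  rw [← toMatrix_mulLeft_extE, ← toMatrix_mulLeft_extE, ← LinearMap.toMatrix_comp,
    ← LinearMap.toMatrix_comp, ← map_neg]
  congr 1
  refine LinearMap.ext fun x => ?_
  simp only [LinearMap.comp_apply, LinearMap.mulLeft_apply, LinearMap.neg_apply]
  rw [← mul_assoc, ← mul_assoc, extE_mul_extE, neg_mul]

/-! ## Intertwining relations of the compound matrices -/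

/-- The induced map is an algebra homomorphism: `Λg(e_j ∧ x) = (g e_j) ∧ Λg x`. -/
theorem compound_mul_creation (g : Matrix (Fin n) (Fin n) ℂ) (j : Fin n) :
    compound g * creation j = (∑ i, g i j • creation i) * compound g := by
  have h : ∑ i, g i j • creation i = LinearMap.toMatrix (extBasis n) (extBasis n)
      (LinearMap.mulLeft ℂ (ExteriorAlgebra.ι ℂ (Matrix.toLin' g (Pi.single j 1)))) := by
    have h1 : Matrix.toLin' g (Pi.single j 1) = ∑ i, g i j • (Pi.single i 1 : Fin n → ℂ) := by
      ext k
      simp [Finset.sum_apply, Pi.single_apply]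
    have h2 : LinearMap.mulLeft ℂ (ExteriorAlgebra.ι ℂ (Matrix.toLin' g (Pi.single j 1))) =
        ∑ i, g i j • LinearMap.mulLeft ℂ (extE i) := by
      refine LinearMap.ext fun x => ?_
      simp [h1, Finset.sum_mul, LinearMap.sum_apply]
    rw [h2, map_sum]
    refine Finset.sum_congr rfl fun i _ => ?_
    rw [map_smul, toMatrix_mulLeft_extE]
  rw [h, ← toMatrix_mulLeft_extE, compound, ← LinearMap.toMatrix_comp, ← LinearMap.toMatrix_comp]
  congr 1
  refine LinearMap.ext fun x => ?_
  simp [ExteriorAlgebra.map_apply_ι]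

theorem compound_vacuum (g : Matrix (Fin n) (Fin n) ℂ) (S : Finset (Fin n)) :
    compound g S ∅ = if S = ∅ then 1 else 0 := by
  rw [compound, LinearMap.toMatrix_apply]
  have : (Pi.basisFun ℂ (Fin n)).ExteriorAlgebra ∅ = 1 := extBasis_empty
  rw [this, AlgHom.toLinearMap_apply, map_one, ← this, Module.Basis.repr_self,
    Finsupp.single_apply]
  simp [eq_comm]

theorem compound_one : compound (1 : Matrix (Fin n) (Fin n) ℂ) = 1 := by
  simp [compound, Matrix.toLin'_one, ExteriorAlgebra.map_id]

/-- A column of an operator of positive weight is a column of its product with a creation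
operator. -/
theorem mul_creation_apply_of_lt {m : Fin n} {T : Finset (Fin n)} (h : ∀ q ∈ T, m < q) (M : Op n)
    (S : Finset (Fin n)) : (M * creation m) S T = M S (insert m T) := by
  have hm : m ∉ T := fun h' => (h m h').false
  have hs : jwSign m T = 1 := by
    rw [jwSign, Finset.filter_eq_empty_iff.2 fun q hq => (h q hq).not_gt]
    simp
  rw [Matrix.mul_apply, Finset.sum_eq_single (insert m T)]
  · simp [creation_apply, hm, hs]
  · intro R _ hR
    simp [creation_apply, hR]
  · simp

/-- Two operators with the same intertwining relations and the same vacuum column are equal. -/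
theorem eq_of_mul_creation_eq {M N : Op n} (D : Fin n → Op n)
    (hM : ∀ j, M * creation j = D j * M) (hN : ∀ j, N * creation j = D j * N)
    (h0 : ∀ S, M S ∅ = N S ∅) : M = N := by
  ext S T
  induction T using Finset.induction_on_min generalizing S with
  | empty => exact h0 S
  | insert m T hm ih =>
    rw [← mul_creation_apply_of_lt hm M, ← mul_creation_apply_of_lt hm N, hM, hN,
      Matrix.mul_apply, Matrix.mul_apply]
    exact Finset.sum_congr rfl fun R _ => by rw [ih R]

theorem creation_apply_empty_left (i : Fin n) (T : Finset (Fin n)) : creation i ∅ T = 0 := by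
  rw [creation_apply, if_neg]
  rintro ⟨-, h⟩
  exact Finset.insert_ne_empty i T h.symm

/-- A nonempty column lies in the range of creation operators by the intertwining relation, and that
range has no vacuum component. -/
theorem compound_apply_empty_left (g : Matrix (Fin n) (Fin n) ℂ) (T : Finset (Fin n)) :
    compound g ∅ T = if T = ∅ then 1 else 0 := by
  induction T using Finset.induction_on_min with
  | empty => simp [compound_vacuum]
  | insert m T hm ih =>
    rw [← mul_creation_apply_of_lt hm (compound g), compound_mul_creation, Matrix.mul_apply]
    simp [Matrix.sum_apply, creation_apply_empty_left]

/-! ## Unitarity of the compound matrices -/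

/-- The creation operator of the `j`-th column of `g`. -/
def columnCreation (g : Matrix (Fin n) (Fin n) ℂ) (j : Fin n) : Op n :=
  ∑ i, g i j • creation i

theorem columnCreation_conjTranspose (g : Matrix (Fin n) (Fin n) ℂ) (j : Fin n) :
    (columnCreation g j)ᴴ = ∑ i, star (g i j) • (creation i)ᴴ := by
  simp [columnCreation, Matrix.conjTranspose_sum, Matrix.conjTranspose_smul]

/-- The anticommutator is sesquilinear, so it equals the inner product of the two columns of `g`. -/
theorem columnCreation_anticomm {g : Matrix (Fin n) (Fin n) ℂ} (hg : gᴴ * g = 1) (i j : Fin n) :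
    (columnCreation g i)ᴴ * columnCreation g j + columnCreation g j * (columnCreation g i)ᴴ =
      if i = j then 1 else 0 := by
  have h1 : (columnCreation g i)ᴴ * columnCreation g j +
      columnCreation g j * (columnCreation g i)ᴴ = ∑ k, ∑ l, (star (g k i) * g l j) •
        ((creation k)ᴴ * creation l + creation l * (creation k)ᴴ) := by
    rw [columnCreation_conjTranspose, columnCreation, Finset.sum_mul_sum, Finset.sum_mul_sum,
      Finset.sum_comm (s := Finset.univ) (t := Finset.univ)
        (f := fun l k => g l j • creation l * star (g k i) • (creation k)ᴴ),
      ← Finset.sum_add_distrib]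
    refine Finset.sum_congr rfl fun k _ => ?_
    rw [← Finset.sum_add_distrib]
    refine Finset.sum_congr rfl fun l _ => ?_
    rw [smul_mul_smul_comm, smul_mul_smul_comm, mul_comm (g l j), smul_add]
  have h2 := congrFun (congrFun hg i) j
  rw [Matrix.mul_apply, Matrix.one_apply] at h2
  rw [h1]
  simp only [annihilation_creation, smul_ite, smul_zero, Finset.sum_ite_eq, Finset.mem_univ,
    if_true, ← Finset.sum_smul]
  simp only [Matrix.conjTranspose_apply] at h2
  rw [h2]
  split_ifs <;> simp

theorem annihilation_apply_empty_right (i : Fin n) (S : Finset (Fin n)) :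
    (creation i)ᴴ S ∅ = 0 := by
  rw [Matrix.conjTranspose_apply, creation_apply_empty_left, star_zero]

theorem compound_mul_annihilation {g : Matrix (Fin n) (Fin n) ℂ} (hg : gᴴ * g = 1) (i : Fin n) :
    compound g * (creation i)ᴴ = (columnCreation g i)ᴴ * compound g := by
  rw [← sub_eq_zero]
  -- The difference of the two sides obeys an intertwining relation with a minus sign, because the
  -- constant terms of the two anticommutators cancel. It also kills the vacuum; the zero operator
  -- has the same two properties.
  refine eq_of_mul_creation_eq (fun k => -columnCreation g k) (fun k => ?_) (by simp) fun S => ?_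
  · have hC : compound g * creation k = columnCreation g k * compound g :=
      compound_mul_creation g k
    have h1 : (creation i)ᴴ * creation k =
        (if i = k then 1 else 0) - creation k * (creation i)ᴴ :=
      eq_sub_of_add_eq (annihilation_creation i k)
    have h2 : (columnCreation g i)ᴴ * columnCreation g k =
        (if i = k then 1 else 0) - columnCreation g k * (columnCreation g i)ᴴ :=
      eq_sub_of_add_eq (columnCreation_anticomm hg i k)
    rw [sub_mul, mul_assoc, mul_assoc, h1, hC, ← mul_assoc _ (columnCreation g k), h2, mul_sub,
      sub_mul, ← mul_assoc, hC]
    by_cases h : i = k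
    · simp only [h, if_true]; noncomm_ring
    · simp only [h, if_false]; noncomm_ring
  · simp only [Matrix.sub_apply, Matrix.mul_apply, annihilation_apply_empty_right, mul_zero,
      Finset.sum_const_zero, compound_vacuum, mul_ite, mul_one, Finset.sum_ite_eq',
      Finset.mem_univ, if_true, columnCreation_conjTranspose, Matrix.sum_apply, Matrix.smul_apply,
      smul_zero, sub_zero, Matrix.zero_apply]

/-- The adjoint of `compound_mul_annihilation` carries column creation operators back to `creation
j`, so the product commutes with every creation operator and fixes the vacuum, as the identity does.
-/
theorem compound_conjTranspose_mul_self {g : Matrix (Fin n) (Fin n) ℂ} (hg : gᴴ * g = 1) :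
    (compound g)ᴴ * compound g = 1 := by
  refine eq_of_mul_creation_eq creation (fun j => ?_) (by simp) fun S => ?_
  · have h := congrArg Matrix.conjTranspose (compound_mul_annihilation hg j)
    simp only [Matrix.conjTranspose_mul, Matrix.conjTranspose_conjTranspose] at h
    rw [mul_assoc, compound_mul_creation, ← mul_assoc, ← mul_assoc, h]
    rfl
  · simp only [Matrix.mul_apply, compound_vacuum, mul_ite, mul_one, mul_zero, Finset.sum_ite_eq',
      Finset.mem_univ, if_true, Matrix.conjTranspose_apply, compound_apply_empty_left,
      Matrix.one_apply]
    split_ifs <;> simp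

/-! ## Second quantization -/

/-- The derivation `∑ a_ij c_i† c_j` of the exterior algebra induced by the matrix `a`. -/
def dGamma : Matrix (Fin n) (Fin n) ℂ →ₗ[ℂ] Op n where
  toFun a := ∑ i, ∑ j, a i j • (creation i * (creation j)ᴴ)
  map_add' a b := by simp [add_smul, Finset.sum_add_distrib]
  map_smul' c a := by simp [mul_smul, Finset.smul_sum]

theorem dGamma_apply (a : Matrix (Fin n) (Fin n) ℂ) :
    dGamma a = ∑ i, ∑ j, a i j • (creation i * (creation j)ᴴ) := rfl

theorem dGamma_single (i j : Fin n) (c : ℂ) :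
    dGamma (Matrix.single i j c) = c • (creation i * (creation j)ᴴ) := by
  rw [dGamma_apply, Finset.sum_eq_single i, Finset.sum_eq_single j] <;>
    simp +contextual [Matrix.single_apply, eq_comm]

theorem dGamma_conjTranspose (a : Matrix (Fin n) (Fin n) ℂ) : (dGamma a)ᴴ = dGamma aᴴ := by
  simp only [dGamma_apply, Matrix.conjTranspose_sum, Matrix.conjTranspose_smul,
    Matrix.conjTranspose_mul, Matrix.conjTranspose_conjTranspose, Matrix.conjTranspose_apply]
  exact Finset.sum_comm

/-- `[c_i† c_j, c_m†] = δ_jm c_i†`: second quantization acts on creation operators as `a` acts on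
basis vectors. -/
theorem dGamma_mul_creation (a : Matrix (Fin n) (Fin n) ℂ) (m : Fin n) :
    dGamma a * creation m - creation m * dGamma a = ∑ i, a i m • creation i := by
  have key : ∀ i j : Fin n, creation i * (creation j)ᴴ * creation m -
      creation m * (creation i * (creation j)ᴴ) = if j = m then creation i else 0 := by
    intro i j
    have h1 : (creation j)ᴴ * creation m =
        (if j = m then 1 else 0) - creation m * (creation j)ᴴ :=
      eq_sub_of_add_eq (annihilation_creation j m)
    rw [mul_assoc, h1, mul_sub, ← mul_assoc, ← mul_assoc, creation_mul_creation i m]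
    split_ifs <;> noncomm_ring
  simp only [dGamma_apply, Finset.sum_mul, Finset.mul_sum, ← Finset.sum_sub_distrib,
    smul_mul_assoc, mul_smul_comm, ← smul_sub, key]
  simp

theorem dGamma_mul_annihilation (a : Matrix (Fin n) (Fin n) ℂ) (m : Fin n) :
    dGamma a * (creation m)ᴴ - (creation m)ᴴ * dGamma a = -∑ j, a m j • (creation j)ᴴ := by
  have h := congrArg Matrix.conjTranspose (dGamma_mul_creation aᴴ m)
  simp only [Matrix.conjTranspose_sub, Matrix.conjTranspose_mul, dGamma_conjTranspose,
    Matrix.conjTranspose_conjTranspose, Matrix.conjTranspose_sum, Matrix.conjTranspose_smul,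
    Matrix.conjTranspose_apply, star_star] at h
  rw [← h, neg_sub]

/-- Leibniz's rule on `c_i† c_j` reduces this to the commutators with a single creation and a single
annihilation operator. -/
theorem dGamma_commutator (a b : Matrix (Fin n) (Fin n) ℂ) :
    dGamma a * dGamma b - dGamma b * dGamma a = dGamma (a * b - b * a) := by
  have h1 : ∀ i j : Fin n, dGamma a * (creation i * (creation j)ᴴ) -
      creation i * (creation j)ᴴ * dGamma a =
      (∑ k, a k i • (creation k * (creation j)ᴴ)) -
        ∑ k, a j k • (creation i * (creation k)ᴴ) := by
    intro i j
    have e1 := dGamma_mul_creation a i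
    have e2 := dGamma_mul_annihilation a j
    have e3 : dGamma a * (creation i * (creation j)ᴴ) - creation i * (creation j)ᴴ * dGamma a =
        (dGamma a * creation i - creation i * dGamma a) * (creation j)ᴴ +
          creation i * (dGamma a * (creation j)ᴴ - (creation j)ᴴ * dGamma a) := by
      noncomm_ring
    rw [e3, e1, e2]
    simp [Finset.sum_mul, Finset.mul_sum, sub_eq_add_neg]
  have h2 : dGamma a * dGamma b - dGamma b * dGamma a = ∑ i, ∑ j, b i j •
      ((∑ k, a k i • (creation k * (creation j)ᴴ)) -
        ∑ k, a j k • (creation i * (creation k)ᴴ)) := by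
    simp only [← h1]
    rw [dGamma_apply b]
    simp only [Finset.sum_mul, Finset.mul_sum, ← Finset.sum_sub_distrib, smul_mul_assoc,
      mul_smul_comm, ← smul_sub]
  rw [h2, map_sub, dGamma_apply, dGamma_apply]
  simp only [smul_sub, Finset.sum_sub_distrib, Matrix.mul_apply, Finset.sum_smul, Finset.smul_sum,
    smul_smul]
  congr 1
  · rw [Finset.sum_comm]
    refine (Finset.sum_congr rfl fun j _ => Finset.sum_comm).trans ?_
    rw [Finset.sum_comm]
    refine Finset.sum_congr rfl fun k _ => Finset.sum_congr rfl fun j _ =>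
      Finset.sum_congr rfl fun i _ => ?_
    rw [mul_comm]
  · refine Finset.sum_congr rfl fun i _ => ?_
    rw [Finset.sum_comm]

/-- Passing `Λg` through `c_i† c_j` replaces each factor by its column version, and the resulting
coefficients are those of `g x g†`. -/
theorem compound_mul_dGamma {g : Matrix (Fin n) (Fin n) ℂ} (hg : gᴴ * g = 1)
    (x : Matrix (Fin n) (Fin n) ℂ) :
    compound g * dGamma x = dGamma (g * x * gᴴ) * compound g := by
  have h1 : ∀ i j : Fin n, compound g * (creation i * (creation j)ᴴ) =
      columnCreation g i * (columnCreation g j)ᴴ * compound g := by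
    intro i j
    rw [← mul_assoc, compound_mul_creation, mul_assoc, compound_mul_annihilation hg, ← mul_assoc]
    rfl
  have h2 : ∀ i j : Fin n, columnCreation g i * (columnCreation g j)ᴴ =
      ∑ k, ∑ l, (g k i * star (g l j)) • (creation k * (creation l)ᴴ) := by
    intro i j
    rw [columnCreation_conjTranspose, columnCreation, Finset.sum_mul_sum]
    simp only [smul_mul_smul_comm]
  have h3 : dGamma (g * x * gᴴ) =
      ∑ i, ∑ j, x i j • (columnCreation g i * (columnCreation g j)ᴴ) := by
    rw [dGamma_apply]
    simp only [h2, Finset.smul_sum, smul_smul, Matrix.mul_apply, Finset.sum_mul, Finset.sum_smul,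
      Matrix.conjTranspose_apply]
    symm
    refine (Finset.sum_congr rfl fun i _ => Finset.sum_comm).trans ?_
    rw [Finset.sum_comm]
    refine Finset.sum_congr rfl fun k _ => ?_
    refine (Finset.sum_congr rfl fun i _ => Finset.sum_comm).trans ?_
    rw [Finset.sum_comm]
    refine Finset.sum_congr rfl fun l _ => ?_
    rw [Finset.sum_comm]
    refine Finset.sum_congr rfl fun j _ => Finset.sum_congr rfl fun i _ => ?_
    congr 1
    ring
  rw [dGamma_apply x, h3]
  simp only [Finset.mul_sum, mul_smul_comm, h1, Finset.sum_mul, smul_mul_assoc]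

theorem compound_conj_dGamma {g : Matrix (Fin n) (Fin n) ℂ} (hg : gᴴ * g = 1)
    (x : Matrix (Fin n) (Fin n) ℂ) :
    compound g * dGamma x * (compound g)ᴴ = dGamma (g * x * gᴴ) := by
  rw [compound_mul_dGamma hg, mul_assoc,
    mul_eq_one_comm.1 (compound_conjTranspose_mul_self hg), mul_one]

theorem creation_mul_annihilation_diag (i j : Fin n) (S : Finset (Fin n)) :
    (creation i * (creation j)ᴴ) S S = if i = j ∧ i ∈ S then 1 else 0 := by
  rw [Matrix.mul_apply]
  split_ifs with h
  · obtain ⟨rfl, hi⟩ := h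
    rw [Finset.sum_eq_single (S.erase i)]
    · simp [creation_apply, Finset.insert_erase hi, Matrix.conjTranspose_apply, jwSign,
        ← mul_pow]
    · intro T _ hT
      rw [creation_apply, if_neg, zero_mul]
      rintro ⟨h1, h2⟩
      exact hT (by rw [h2, Finset.erase_insert h1])
    · simp
  · refine Finset.sum_eq_zero fun T _ => ?_
    rw [Matrix.conjTranspose_apply, creation_apply, creation_apply]
    by_cases h1 : i ∉ T ∧ S = insert i T
    · rw [if_neg (c := j ∉ T ∧ S = insert j T), star_zero, mul_zero]
      rintro ⟨h2, h3⟩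
      refine h ⟨?_, h1.2 ▸ Finset.mem_insert_self _ _⟩
      have : i ∈ insert j T := h3 ▸ h1.2 ▸ Finset.mem_insert_self _ _
      exact (Finset.mem_insert.1 this).resolve_right h1.1
    · rw [if_neg h1, zero_mul]

/-- Only the number operators `c_i† c_i` have diagonal entries. Hence the state `|S⟩` sees `a` only
through its trace against the coordinate projection of `S`. -/
theorem dGamma_diag (a : Matrix (Fin n) (Fin n) ℂ) (S : Finset (Fin n)) :
    dGamma a S S = ∑ i ∈ S, a i i := by
  simp only [dGamma_apply, Matrix.sum_apply, Matrix.smul_apply, creation_mul_annihilation_diag,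
    smul_eq_mul, ite_and, mul_ite, mul_one, mul_zero, Finset.sum_ite_eq, Finset.mem_univ, if_true]
  simp

/-! ## The differential of the compound representation -/

section

attribute [local instance] Matrix.linftyOpNormedRing Matrix.linftyOpNormedAlgebra

theorem hasDerivAt_exp_smul_apply (a : Matrix (Fin n) (Fin n) ℂ) (i j : Fin n) :
    HasDerivAt (fun t : ℝ => NormedSpace.exp (t • a) i j) (a i j) 0 := by
  have h := hasDerivAt_exp_smul_const (𝕂 := ℝ) a (0 : ℝ)
  rw [zero_smul, NormedSpace.exp_zero, one_mul] at h
  exact hasDerivAt_pi.1 (hasDerivAt_pi.1 h i) j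

end

/-- No minors are expanded: the intertwining relation expresses a column through a column of smaller
weight, and the product rule turns this recursion into the commutation relation
`dGamma_mul_creation`. -/
theorem hasDerivAt_compound_exp (a : Matrix (Fin n) (Fin n) ℂ) (S T : Finset (Fin n)) :
    HasDerivAt (fun t : ℝ => compound (NormedSpace.exp (t • a)) S T) (dGamma a S T) 0 := by
  induction T using Finset.induction_on_min generalizing S with
  | empty =>
    have : dGamma a S ∅ = 0 := by
      simp [dGamma_apply, Matrix.sum_apply, Matrix.mul_apply, creation_apply_empty_left]
    simp only [compound_vacuum, this]
    exact hasDerivAt_const _ _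
  | insert m T hm ih =>
    have hfun : (fun t : ℝ => compound (NormedSpace.exp (t • a)) S (insert m T)) = fun t : ℝ =>
        ∑ R, (∑ i, NormedSpace.exp (t • a) i m * creation i S R) *
          compound (NormedSpace.exp (t • a)) R T := by
      funext t
      rw [← mul_creation_apply_of_lt hm (compound _), compound_mul_creation, Matrix.mul_apply]
      simp [Matrix.sum_apply]
    rw [hfun]
    have hd := HasDerivAt.fun_sum (u := Finset.univ) fun R _ =>
      (HasDerivAt.fun_sum (u := Finset.univ) fun i _ =>
        (hasDerivAt_exp_smul_apply a i m).mul_const (creation i S R)).fun_mul (ih R)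
    refine hd.congr_deriv ?_
    have h1 : dGamma a * creation m = (∑ i, a i m • creation i) + creation m * dGamma a :=
      sub_eq_iff_eq_add.1 (dGamma_mul_creation a m)
    rw [← mul_creation_apply_of_lt hm (dGamma a), h1, Matrix.add_apply, Matrix.mul_apply,
      Finset.sum_add_distrib]
    simp [NormedSpace.exp_zero, compound_one, Matrix.one_apply, Matrix.sum_apply]

theorem dphi_eq_dGamma (a : Matrix (Fin n) (Fin n) ℂ) : dphi a = dGamma a := by
  ext S T
  exact (hasDerivAt_compound_exp a S T).deriv

/-! ## The generators as second-quantized matrices -/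

theorem creation_mul_annihilation_of_lt {i j : Fin n} (hij : i < j) :
    creation i * (creation j)ᴴ = stringOp i j raising lowering := by
  rw [creation_conjTranspose, creation, tensorOp_mul, stringOp]
  congr 1
  funext q
  rcases lt_trichotomy q i with h | h | h
  · simp [h, h.ne, h.trans hij, (h.trans hij).ne, h.not_gt, pauliZ_mul_pauliZ]
  · subst h; simp [hij, raising_mul_pauliZ]
  · rcases lt_trichotomy q j with h' | h' | h'
    · simp [h, h.not_gt, h.ne', h', h'.ne]
    · subst h'; simp [h.not_gt, h.ne']
    · simp [h.not_gt, h.ne', h'.not_gt, h'.ne']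

theorem creation_mul_annihilation_of_gt {i j : Fin n} (hij : i < j) :
    creation j * (creation i)ᴴ = stringOp i j lowering raising := by
  rw [creation_conjTranspose, creation, tensorOp_mul, stringOp]
  congr 1
  funext q
  rcases lt_trichotomy q i with h | h | h
  · simp [h, h.ne, h.trans hij, (h.trans hij).ne, h.not_gt, pauliZ_mul_pauliZ]
  · subst h; simp [hij, pauliZ_mul_lowering]
  · rcases lt_trichotomy q j with h' | h' | h'
    · simp [h, h.not_gt, h.ne', h', h'.ne]
    · subst h'; simp [h.not_gt, h.ne']
    · simp [h.not_gt, h.ne', h'.not_gt, h'.ne']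

/-- Isolates the two end sites. The remaining factor is common to all strings on `i`, `j`, so
identities among generators reduce to the sixteen entries of a two-qubit identity. -/
theorem stringOp_apply {i j : Fin n} (hij : i ≠ j) (A B : Matrix (Fin 2) (Fin 2) ℂ)
    (S T : Finset (Fin n)) : stringOp i j A B S T =
      A (bit S i) (bit T i) * (B (bit S j) (bit T j) * ∏ q ∈ (Finset.univ.erase i).erase j,
        (if i < q ∧ q < j then pauliZ else 1) (bit S q) (bit T q)) := by
  simp only [stringOp, tensorOp, Matrix.of_apply]
  rw [← Finset.mul_prod_erase _ _ (Finset.mem_univ i), ← Finset.mul_prod_erase _ _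
    (Finset.mem_erase.2 ⟨hij.symm, Finset.mem_univ j⟩), if_pos rfl, if_neg hij.symm, if_pos rfl]
  congr 2
  refine Finset.prod_congr rfl fun q hq => ?_
  have h1 := Finset.mem_erase.1 hq
  rw [if_neg (Finset.ne_of_mem_erase h1.2), if_neg h1.1]

theorem pauli_xx_add_yy (a b c d : Fin 2) :
    pauliX a b * pauliX c d + pauliY a b * pauliY c d =
      2 * (raising a b * lowering c d + lowering a b * raising c d) := by
  fin_cases a <;> fin_cases b <;> fin_cases c <;> fin_cases d <;>
    simp [pauliX, pauliY, raising, lowering] <;> norm_num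

theorem pauli_yx_sub_xy (a b c d : Fin 2) :
    pauliY a b * pauliX c d - pauliX a b * pauliY c d =
      2 * I * (raising a b * lowering c d - lowering a b * raising c d) := by
  fin_cases a <;> fin_cases b <;> fin_cases c <;> fin_cases d <;>
    simp [pauliX, pauliY, raising, lowering] <;> ring

theorem hx_eq {i j : Fin n} (hij : i < j) :
    hx i j = dGamma (Matrix.single i j (-(I / 2)) + Matrix.single j i (-(I / 2))) := by
  rw [map_add, dGamma_single, dGamma_single, creation_mul_annihilation_of_lt hij,
    creation_mul_annihilation_of_gt hij, ← smul_add]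
  ext S T
  simp only [hx, Matrix.smul_apply, Matrix.add_apply, stringOp_apply hij.ne, smul_eq_mul]
  rw [← mul_assoc, ← mul_assoc, ← mul_assoc, ← mul_assoc, ← add_mul, ← add_mul, pauli_xx_add_yy]
  ring

theorem hy_eq {i j : Fin n} (hij : i < j) :
    hy i j = dGamma (Matrix.single i j (1 / 2) - Matrix.single j i (1 / 2)) := by
  rw [map_sub, dGamma_single, dGamma_single, creation_mul_annihilation_of_lt hij,
    creation_mul_annihilation_of_gt hij, ← smul_sub]
  ext S T
  simp only [hy, Matrix.smul_apply, Matrix.sub_apply, stringOp_apply hij.ne, smul_eq_mul]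
  rw [← mul_assoc, ← mul_assoc, ← mul_assoc, ← mul_assoc, ← sub_mul, ← sub_mul, pauli_yx_sub_xy]
  ring_nf
  rw [I_sq]
  ring

theorem onQubit_pauliZ (i : Fin n) :
    onQubit i pauliZ = 1 - (2 : ℂ) • (creation i * (creation i)ᴴ) := by
  have hf : ∀ A : Matrix (Fin 2) (Fin 2) ℂ, (fun q : Fin n => if q = i then A else 1) =
      Function.update (fun _ => 1) i A := by
    intro A
    funext q
    by_cases h : q = i
    · subst h; simp
    · simp [h]
  have h1 : creation i * (creation i)ᴴ =
      tensorOp (Function.update (fun _ => 1) i (raising * lowering)) := by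
    rw [creation_conjTranspose, creation, tensorOp_mul, ← hf]
    congr 1
    funext q
    rcases lt_trichotomy q i with h | h | h
    · simp [h, h.ne, pauliZ_mul_pauliZ]
    · subst h; simp
    · simp [h.not_gt, h.ne']
  have h2 : pauliZ = 1 + (-2 : ℂ) • (raising * lowering) := by
    ext a b
    fin_cases a <;> fin_cases b <;> simp [pauliZ, raising, lowering]; norm_num
  rw [onQubit, hf, h1, h2, tensorOp_update_add, tensorOp_update_smul,
    Function.update_eq_self_iff.2 rfl, tensorOp_one, neg_smul, sub_eq_add_neg]

theorem hz_eq (i j : Fin n) :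
    hz i j = dGamma (Matrix.single i i (I / 2) - Matrix.single j j (I / 2)) := by
  rw [map_sub, dGamma_single, dGamma_single, hz, onQubit_pauliZ, onQubit_pauliZ, ← smul_sub,
    sub_sub_sub_cancel_left, ← smul_sub, smul_smul, ← neg_sub, smul_neg, ← neg_smul]
  congr 1
  ring

/-! ## `𝔰𝔲(n)` and the dynamical Lie algebra -/

theorem su_commutator {a b : Matrix (Fin n) (Fin n) ℂ} (ha : aᴴ = -a) (hb : bᴴ = -b) :
    a * b - b * a ∈ su n := by
  refine ⟨?_, ?_⟩
  · rw [Matrix.conjTranspose_sub, Matrix.conjTranspose_mul, Matrix.conjTranspose_mul, ha, hb]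
    noncomm_ring
  · rw [Matrix.trace_sub, Matrix.trace_mul_comm, sub_self]

/-- The image of `𝔰𝔲(n)` under second quantization, as a real Lie algebra. -/
def dGammaSU (n : ℕ) : LieSubalgebra ℝ (Op n) where
  carrier := dGamma '' su n
  zero_mem' := ⟨0, by simp [su], map_zero _⟩
  add_mem' := by
    rintro _ _ ⟨a, ha, rfl⟩ ⟨b, hb, rfl⟩
    refine ⟨a + b, ⟨?_, ?_⟩, map_add _ _ _⟩
    · rw [Matrix.conjTranspose_add, ha.1, hb.1, neg_add]
    · rw [Matrix.trace_add, ha.2, hb.2, add_zero]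
  smul_mem' := by
    rintro c _ ⟨a, ha, rfl⟩
    refine ⟨(c : ℂ) • a, ⟨?_, ?_⟩, ?_⟩
    · rw [Matrix.conjTranspose_smul, ha.1, smul_neg]
      simp
    · rw [Matrix.trace_smul, ha.2, smul_zero]
    · rw [map_smul]
      exact Complex.coe_smul c _
  lie_mem' := by
    rintro _ _ ⟨a, ha, rfl⟩ ⟨b, hb, rfl⟩
    exact ⟨_, su_commutator ha.1 hb.1, (dGamma_commutator a b).symm⟩

theorem single_pair_mem_su {i j : Fin n} (hij : i ≠ j) (z : ℂ) :
    Matrix.single i j z - Matrix.single j i (star z) ∈ su n := by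
  refine ⟨?_, ?_⟩
  · rw [Matrix.conjTranspose_sub, Matrix.conjTranspose_single, Matrix.conjTranspose_single,
      star_star, neg_sub]
  · rw [Matrix.trace_sub, Matrix.trace_single_eq_of_ne _ _ _ hij,
      Matrix.trace_single_eq_of_ne _ _ _ hij.symm, sub_zero]

theorem single_diag_mem_su (i j : Fin n) {z : ℂ} (hz : star z = -z) :
    Matrix.single i i z - Matrix.single j j z ∈ su n := by
  refine ⟨?_, ?_⟩
  · rw [Matrix.conjTranspose_sub, Matrix.conjTranspose_single, Matrix.conjTranspose_single, hz,
      neg_sub, ← Matrix.single_neg, ← Matrix.single_neg]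
    abel
  · simp

theorem stdNormSq_single_pair {i j : Fin n} (hij : i ≠ j) (z : ℂ) :
    stdNormSq (Matrix.single i j z - Matrix.single j i (star z)) = 2 * Complex.normSq z := by
  simp [stdNormSq, sub_mul, mul_sub, hij, hij.symm, Complex.mul_conj, Complex.normSq_apply]
  ring

theorem stdNormSq_single_diag {i j : Fin n} (hij : i ≠ j) (z : ℂ) :
    stdNormSq (Matrix.single i i z - Matrix.single j j z) = -(2 * (z * z).re) := by
  simp [stdNormSq, sub_mul, mul_sub, hij, hij.symm]
  ring

theorem star_I_div_two : star (I / 2) = -(I / 2) := by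
  simp [neg_div]

/-- The common value `1/2` of the norm is what makes the variance independent of the choice of
generator. -/
theorem exists_su_of_mem_generators {H : Op n} (hH : H ∈ generators n) :
    ∃ h ∈ su n, H = dGamma h ∧ stdNormSq h = 1 / 2 := by
  obtain ⟨i, j, hij, rfl | rfl | rfl⟩ := hH
  · refine ⟨_, single_pair_mem_su hij.ne (-(I / 2)), ?_, ?_⟩
    · rw [hx_eq hij, star_neg, star_I_div_two, neg_neg, ← sub_neg_eq_add, Matrix.single_neg j i,
        neg_neg]
    · rw [stdNormSq_single_pair hij.ne]
      norm_num [Complex.normSq_apply]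
  · refine ⟨_, single_pair_mem_su hij.ne (1 / 2), ?_, ?_⟩
    · rw [hy_eq hij]
      simp
    · rw [stdNormSq_single_pair hij.ne]
      norm_num [Complex.normSq_apply]
  · refine ⟨_, single_diag_mem_su i j star_I_div_two, hz_eq i j, ?_⟩
    rw [stdNormSq_single_diag hij.ne]
    norm_num

theorem generators_subset_dla (n : ℕ) : generators n ⊆ (dla (generators n) : Set (Op n)) :=
  LieSubalgebra.subset_lieSpan

theorem dGamma_single_pair_mem_dla_of_lt {i j : Fin n} (hij : i < j) (z : ℂ) :
    dGamma (Matrix.single i j z - Matrix.single j i (star z)) ∈ dla (generators n) := by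
  have h1 : hx i j ∈ dla (generators n) := generators_subset_dla n ⟨i, j, hij, Or.inl rfl⟩
  have h2 : hy i j ∈ dla (generators n) :=
    generators_subset_dla n ⟨i, j, hij, Or.inr (Or.inl rfl)⟩
  -- The real part of `z` is supplied by `h_y` and the imaginary part by `h_x`.
  have h3 := add_mem ((dla (generators n)).smul_mem (2 * z.re) h2)
    ((dla (generators n)).smul_mem (-2 * z.im) h1)
  convert h3 using 1
  rw [hx_eq hij, hy_eq hij]
  simp only [map_sub, map_add, dGamma_single, ← smul_sub, ← smul_add]
  rw [← Complex.coe_smul, ← Complex.coe_smul]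
  simp only [smul_smul, smul_sub, smul_add]
  rw [← sub_eq_zero]
  have hz : z = z.re + z.im * I := (Complex.re_add_im z).symm
  have hz' : star z = z.re - z.im * I := by
    apply Complex.ext <;> simp
  rw [hz']
  conv_lhs => enter [1, 1, 1]; rw [hz]
  push_cast
  module

theorem dGamma_single_pair_mem_dla {i j : Fin n} (hij : i ≠ j) (z : ℂ) :
    dGamma (Matrix.single i j z - Matrix.single j i (star z)) ∈ dla (generators n) := by
  rcases hij.lt_or_gt with h | h
  · exact dGamma_single_pair_mem_dla_of_lt h z
  · have := neg_mem (dGamma_single_pair_mem_dla_of_lt h (star z))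
    rwa [← map_neg, neg_sub, star_star] at this

theorem dGamma_single_diag_mem_dla {i j : Fin n} (hij : i ≤ j) (t : ℝ) :
    dGamma (Matrix.single j j (t * I) - Matrix.single i i (t * I)) ∈ dla (generators n) := by
  rcases hij.eq_or_lt with rfl | hlt
  · rw [sub_self, map_zero]
    exact zero_mem _
  · have h1 : hz i j ∈ dla (generators n) :=
      generators_subset_dla n ⟨i, j, hlt, Or.inr (Or.inr rfl)⟩
    have h2 := (dla (generators n)).smul_mem (-2 * t) h1
    convert h2 using 1
    rw [hz_eq]
    simp only [map_sub, dGamma_single]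
    rw [← Complex.coe_smul]
    push_cast
    module

theorem dGamma_mem_dla {a : Matrix (Fin n) (Fin n) ℂ} (ha : a ∈ su n) :
    dGamma a ∈ dla (generators n) := by
  rcases Nat.eq_zero_or_pos n with rfl | hn
  · rw [Subsingleton.elim a 0, map_zero]
    exact zero_mem _
  have hskew : ∀ i j, star (a i j) = -a j i := fun i j => congrFun (congrFun ha.1 j) i
  let z : Fin n := ⟨0, hn⟩
  -- This is `2a = a - aᴴ` summed entry by entry. A diagonal term `2 a_ii E_ii` is not traceless on
  -- its own, so it is paired with `-2 a_ii E_zz`; these corrections add up to `-2 (Tr a) E_zz = 0`.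
  -- The index `z` is the least one, so each pair is ordered as `h_z` requires.
  have hsum : (2 : ℂ) • a = ∑ i, ∑ j, (Matrix.single i j (a i j) -
      Matrix.single j i (star (a i j)) - if i = j then Matrix.single z z (2 * a i i) else 0) := by
    simp only [Finset.sum_sub_distrib, Finset.sum_ite_eq, Finset.mem_univ, if_true]
    rw [← Matrix.matrix_eq_sum_single, Finset.sum_comm (f := fun i j =>
      Matrix.single j i (star (a i j)))]
    have h1 : ∑ j, ∑ i, Matrix.single j i (star (a i j)) = -a := by
      simp only [hskew, ← Matrix.single_neg, Finset.sum_neg_distrib]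
      rw [← Matrix.matrix_eq_sum_single]
    have h2 : ∑ i, Matrix.single z z (2 * a i i) = 0 := by
      have : ∑ i, Matrix.single z z (2 * a i i) = Matrix.single z z (∑ i, 2 * a i i) :=
        (map_sum (Matrix.singleAddMonoidHom (α := ℂ) z z) _ _).symm
      rw [this, ← Finset.mul_sum]
      have h3 : ∑ i, a i i = 0 := ha.2
      rw [h3, mul_zero, Matrix.single_zero]
    rw [h1, h2, sub_neg_eq_add, sub_zero, two_smul]
  have hmem : dGamma ((2 : ℂ) • a) ∈ dla (generators n) := by
    rw [hsum, map_sum]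
    refine sum_mem fun i _ => ?_
    rw [map_sum]
    refine sum_mem fun j _ => ?_
    by_cases hij : i = j
    · subst hij
      have h4 : (2 * a i i) = ((2 * (a i i).im : ℝ) : ℂ) * I := by
        have h5 := congrArg Complex.re (hskew i i)
        simp at h5
        apply Complex.ext
        · simp; linarith
        · simp
      rw [if_pos rfl, hskew, ← Matrix.single_neg, sub_neg_eq_add, ← Matrix.single_add, ← two_mul, h4]
      exact dGamma_single_diag_mem_dla (i := z) (Nat.zero_le _) _
    · rw [if_neg hij, sub_zero]
      exact dGamma_single_pair_mem_dla hij _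
  have h6 := (dla (generators n)).smul_mem (1 / 2 : ℝ) hmem
  rw [map_smul, ← Complex.coe_smul, smul_smul] at h6
  norm_num at h6
  exact h6

theorem dla_generators (n : ℕ) :
    (dla (generators n) : Set (Op n)) = dphi '' su n := by
  have hd : (dphi : Matrix (Fin n) (Fin n) ℂ → Op n) = dGamma := funext dphi_eq_dGamma
  rw [hd]
  refine Set.Subset.antisymm ?_ ?_
  · have : dla (generators n) ≤ dGammaSU n := LieSubalgebra.lieSpan_le.2 fun H hH => by
      obtain ⟨h, hh, rfl, -⟩ := exists_su_of_mem_generators hH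
      exact ⟨h, hh, rfl⟩
    exact this
  · rintro _ ⟨a, ha, rfl⟩
    exact dGamma_mem_dla ha

theorem isLASA_hz {i j : Fin n} (hij : i < j) : IsLASA (generators n) (I • hz i j) := by
  refine ⟨?_, ?_⟩
  · rw [Matrix.IsHermitian, Matrix.conjTranspose_smul, hz_eq, dGamma_conjTranspose,
      (single_diag_mem_su i j star_I_div_two).1, map_neg, smul_neg, ← neg_smul]
    congr 1
    simp
  · rw [smul_smul, I_mul_I, neg_smul, one_smul]
    exact neg_mem (generators_subset_dla n ⟨i, j, hij, Or.inr (Or.inr rfl)⟩)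

theorem exists_su_of_hz {i j : Fin n} (hij : i < j) :
    ∃ o ∈ su n, I • (I • hz i j) = dphi o ∧ stdNormSq o = 1 / 2 := by
  -- The sign from `i² = -1` is absorbed by exchanging `i` and `j`.
  refine ⟨_, single_diag_mem_su j i star_I_div_two, ?_, ?_⟩
  · rw [smul_smul, I_mul_I, neg_smul, one_smul, hz_eq, ← map_neg, neg_sub, dphi_eq_dGamma]
  · rw [stdNormSq_single_diag hij.ne']
    norm_num

/-! ## Bilinear forms on matrices invariant under unitary conjugation -/

/-- A symmetric function on pairs of distinct elements that does not depend on the first of them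
is constant. -/
theorem offDiag_const {ι : Type*} {F : ι → ι → ℂ} (hs : ∀ i j, i ≠ j → F i j = F j i)
    (hc : ∀ p q j, p ≠ q → j ≠ p → j ≠ q → F p j = F q j) {a b c d : ι} (hab : a ≠ b)
    (hcd : c ≠ d) : F a b = F c d := by
  have hc' : ∀ p q j, j ≠ p → j ≠ q → F p j = F q j := by
    intro p q j h1 h2
    by_cases h : p = q
    · rw [h]
    · exact hc p q j h h1 h2
  by_cases hcb : c = b
  · subst hcb
    rw [hc' a d c hab.symm hcd, hs d c hcd.symm]
  · rw [hc' a c b hab.symm (Ne.symm hcb), hs c b hcb, hc' b d c hcb hcd, hs d c hcd.symm]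

theorem linear_eq_sum (L : Matrix (Fin n) (Fin n) ℂ →ₗ[ℂ] ℂ) (X : Matrix (Fin n) (Fin n) ℂ) :
    L X = ∑ i, ∑ j, X i j * L (Matrix.single i j 1) := by
  conv_lhs => rw [Matrix.matrix_eq_sum_single X]
  simp only [map_sum]
  refine Finset.sum_congr rfl fun i _ => Finset.sum_congr rfl fun j _ => ?_
  rw [← smul_eq_mul, ← map_smul, Matrix.smul_single, smul_eq_mul, mul_one]

theorem bilin_eq_sum (B : Matrix (Fin n) (Fin n) ℂ →ₗ[ℂ] Matrix (Fin n) (Fin n) ℂ →ₗ[ℂ] ℂ)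
    (X Y : Matrix (Fin n) (Fin n) ℂ) : B X Y = ∑ i, ∑ j, ∑ k, ∑ l,
      X i j * (Y k l * B (Matrix.single i j 1) (Matrix.single k l 1)) := by
  rw [← LinearMap.flip_apply, linear_eq_sum]
  refine Finset.sum_congr rfl fun i _ => Finset.sum_congr rfl fun j _ => ?_
  rw [LinearMap.flip_apply, linear_eq_sum]
  simp only [Finset.mul_sum]

theorem trace_single_one (i j : Fin n) :
    (Matrix.single i j (1 : ℂ)).trace = if i = j then 1 else 0 := by
  split_ifs with hij
  · subst hij; simp
  · simp [hij]

/-- Classification of the invariant bilinear forms on `𝔤𝔩(n)`. -/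
theorem eq_trace_of_commutator_invariant (hn : 2 ≤ n)
    (B : Matrix (Fin n) (Fin n) ℂ →ₗ[ℂ] Matrix (Fin n) (Fin n) ℂ →ₗ[ℂ] ℂ)
    (hB : ∀ a X Y, B (a * X - X * a) Y + B X (a * Y - Y * a) = 0) :
    ∃ α β : ℂ, ∀ X Y, B X Y = α * (X.trace * Y.trace) + β * (X * Y).trace := by
  set f : Fin n → Fin n → Fin n → Fin n → ℂ := fun i j k l =>
    B (Matrix.single i j 1) (Matrix.single k l 1) with hf
  have hcomm : ∀ p q i j : Fin n, Matrix.single p q (1 : ℂ) * Matrix.single i j 1 -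
      Matrix.single i j 1 * Matrix.single p q 1 =
      (if q = i then Matrix.single p j 1 else 0) - if j = p then Matrix.single i q 1 else 0 := by
    intro p q i j
    congr 1
    · split_ifs with h
      · subst h; simp
      · simp [h]
    · split_ifs with h
      · subst h; simp
      · simp [h]
  -- Invariance under the matrix unit `E_pq`, tested on matrix units: all relations below are
  -- instances of this one.
  have hR : ∀ p q i j k l : Fin n, (if q = i then f p j k l else 0) -
      (if j = p then f i q k l else 0) + ((if q = k then f i j p l else 0) -
      if l = p then f i j k q else 0) = 0 := by
    intro p q i j k l
    have h := hB (Matrix.single p q 1) (Matrix.single i j 1) (Matrix.single k l 1)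
    have e1 : ∀ (c : Prop) [Decidable c] (A Z : Matrix (Fin n) (Fin n) ℂ),
        B (if c then A else 0) Z = if c then B A Z else 0 := by
      intro c _ A Z
      split_ifs <;> simp
    have e2 : ∀ (c : Prop) [Decidable c] (A Z : Matrix (Fin n) (Fin n) ℂ),
        B A (if c then Z else 0) = if c then B A Z else 0 := by
      intro c _ A Z
      split_ifs <;> simp
    rw [hcomm, hcomm, map_sub, map_sub, LinearMap.sub_apply, e1, e1, e2, e2] at h
    exact h
  have h01 : ∃ a b : Fin n, a ≠ b := ⟨⟨0, by omega⟩, ⟨1, by omega⟩, by simp⟩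
  -- A pair of matrix units of nonzero weight under diagonal matrices pairs to zero. Only `f i i k
  -- k` and `f i j j i` can survive.
  have hoff : ∀ i j k l, i ≠ j → ¬ (i = l ∧ k = j) → f i j k l = 0 := by
    intro i j k l hij hkl
    by_cases hl : i = l
    · have hk : k ≠ j := fun hk => hkl ⟨hl, hk⟩
      subst hl
      have h := hR j j i j k i
      rw [if_neg hij.symm, if_pos rfl, if_neg hk.symm, if_neg hij] at h
      linear_combination -h
    · have h := hR i i i j k l
      rw [if_pos rfl, if_neg hij.symm, if_neg (Ne.symm hl)] at h
      by_cases hk : i = k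
      · subst hk
        rw [if_pos rfl] at h
        linear_combination h / 2
      · rw [if_neg hk] at h
        linear_combination h
  have hdiag : ∀ i k l, k ≠ l → f i i k l = 0 := by
    intro i k l hkl
    have h := hR k k i i k l
    rw [if_pos rfl (c := k = k), if_neg hkl.symm] at h
    by_cases hk : k = i
    · subst hk
      simp only [if_true] at h
      linear_combination h
    · rw [if_neg hk, if_neg (Ne.symm hk)] at h
      linear_combination h
  -- `hA` and `hgc` remove the dependence on the first index, but are vacuous when `n = 2`. The
  -- symmetries `hhs` and `hgs`, extracted from `hB1`, `hB2`, `hB3`, complete the argument, and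
  -- `hB1` also determines the entries `f i i i i`.
  have hA : ∀ p q k, p ≠ q → k ≠ p → k ≠ q → f p p k k = f q q k k := by
    intro p q k h1 h2 h3
    have h := hR p q q p k k
    rw [if_pos rfl, if_pos rfl, if_neg h3.symm, if_neg h2] at h
    linear_combination h
  have hB1 : ∀ p q, p ≠ q → f q q q q = f p p q q + f q p p q := by
    intro p q h1
    have h := hR p q q p q q
    rw [if_pos rfl, if_pos rfl, if_pos rfl, if_neg h1.symm] at h
    linear_combination -h
  have hB2 : ∀ p q, p ≠ q → f p p p p = f q q p p + f q p p q := by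
    intro p q h1
    have h := hR p q q p p p
    rw [if_pos rfl, if_pos rfl, if_neg h1.symm, if_pos rfl] at h
    linear_combination h
  have hB3 : ∀ p q, p ≠ q → f q q q q = f q q p p + f p q q p := by
    intro p q h1
    have h := hR p q q q q p
    rw [if_pos rfl, if_neg h1.symm, if_pos rfl, if_pos rfl] at h
    linear_combination -h
  have hgs : ∀ p q, p ≠ q → f p q q p = f q p p q := by
    intro p q h1
    linear_combination hB1 p q h1 - hB2 q p h1.symm
  have hhs : ∀ p q, p ≠ q → f p p q q = f q q p p := by
    intro p q h1
    linear_combination hB3 p q h1 - hB1 p q h1 + hgs p q h1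
  have hgc : ∀ p q j, p ≠ q → j ≠ p → j ≠ q → f p j j p = f q j j q := by
    intro p q j h1 h2 h3
    have h := hR p q q j j p
    rw [if_pos rfl, if_neg h2, if_neg h3.symm, if_pos rfl] at h
    linear_combination h
  obtain ⟨a, b, hab⟩ := h01
  refine ⟨f a a b b, f a b b a, ?_⟩
  have hval : ∀ i j k l, f i j k l = f a a b b * ((if i = j then 1 else 0) *
      if k = l then 1 else 0) + f a b b a * if i = l ∧ k = j then 1 else 0 := by
    intro i j k l
    by_cases hij : i = j
    · subst hij
      by_cases hkl : k = l
      · subst hkl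
        by_cases hik : i = k
        · subst hik
          obtain ⟨p, hp⟩ : ∃ p, p ≠ i := by
            by_cases h : a = i
            · exact ⟨b, fun hb => hab (h.trans hb.symm)⟩
            · exact ⟨a, h⟩
          rw [hB1 p i hp, offDiag_const (F := fun i k => f i i k k) hhs hA hp hab,
            offDiag_const (F := fun i j => f i j j i) hgs hgc hp.symm hab]
          simp
        · rw [offDiag_const (F := fun i k => f i i k k) hhs hA hik hab]
          simp [hik]
      · rw [hdiag i k l hkl]
        have : ¬ (i = l ∧ k = i) := fun h => hkl (h.2.trans h.1)
        simp [hkl, this]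
    · by_cases hkl : i = l ∧ k = j
      · obtain ⟨rfl, rfl⟩ := hkl
        rw [offDiag_const (F := fun i j => f i j j i) hgs hgc hij hab]
        simp [hij]
      · rw [hoff i j k l hij hkl]
        simp [hij, hkl]
  let B' : Matrix (Fin n) (Fin n) ℂ →ₗ[ℂ] Matrix (Fin n) (Fin n) ℂ →ₗ[ℂ] ℂ :=
    LinearMap.mk₂ ℂ
      (fun X Y => f a a b b * (X.trace * Y.trace) + f a b b a * (X * Y).trace)
      (fun X X' Y => by simp only [Matrix.trace_add, add_mul]; ring)
      (fun c X Y => by simp only [Matrix.trace_smul, smul_mul_assoc, smul_eq_mul]; ring)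
      (fun X Y Y' => by simp only [Matrix.trace_add, mul_add]; ring)
      (fun c X Y => by simp only [Matrix.trace_smul, mul_smul_comm, smul_eq_mul]; ring)
  have hB' : ∀ i j k l, B' (Matrix.single i j 1) (Matrix.single k l 1) = f i j k l := by
    intro i j k l
    rw [hval]
    change f a a b b * ((Matrix.single i j 1).trace * (Matrix.single k l 1).trace) +
      f a b b a * (Matrix.single i j (1 : ℂ) * Matrix.single k l (1 : ℂ)).trace = _
    rw [trace_single_one, trace_single_one]
    congr 2
    by_cases hkj : k = j
    · subst hkj
      rw [Matrix.single_mul_single_same, mul_one, trace_single_one]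
      simp
    · rw [Matrix.single_mul_single_of_ne _ _ _ _ (Ne.symm hkj)]
      simp [hkj]
  intro X Y
  change B X Y = B' X Y
  rw [bilin_eq_sum, bilin_eq_sum B']
  simp only [hB', hf]

/-! ### From unitary invariance to infinitesimal invariance -/

section

attribute [local instance] Matrix.linftyOpNormedRing Matrix.linftyOpNormedAlgebra

theorem hasDerivAt_exp_conj (a X : Matrix (Fin n) (Fin n) ℂ) :
    HasDerivAt (fun t : ℝ => NormedSpace.exp (t • a) * X * NormedSpace.exp (t • -a))
      (a * X - X * a) 0 := by
  have h1 := hasDerivAt_exp_smul_const (𝕂 := ℝ) a (0 : ℝ)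
  have h2 := hasDerivAt_exp_smul_const (𝕂 := ℝ) (-a) (0 : ℝ)
  refine ((h1.mul_const X).mul h2).congr_deriv ?_
  simp [NormedSpace.exp_zero, sub_eq_add_neg]

theorem exp_unitary {a : Matrix (Fin n) (Fin n) ℂ} (ha : aᴴ = -a) (t : ℝ) :
    (NormedSpace.exp (t • a))ᴴ = NormedSpace.exp (t • -a) ∧
      NormedSpace.exp (t • a) ∈ Matrix.unitaryGroup (Fin n) ℂ := by
  have h1 : (NormedSpace.exp (t • a))ᴴ = NormedSpace.exp (t • -a) := by
    rw [← Matrix.exp_conjTranspose, Matrix.conjTranspose_smul, ha]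
    simp
  refine ⟨h1, Matrix.mem_unitaryGroup_iff.2 ?_⟩
  rw [Matrix.star_eq_conjTranspose, h1, smul_neg, Matrix.exp_neg]
  exact Matrix.mul_nonsing_inv _ ((Matrix.isUnit_iff_isUnit_det _).1 (Matrix.isUnit_exp _))

/-- Differentiate the constant function `t ↦ B(e^{ta} X e^{-ta}, e^{ta} Y e^{-ta})` at `0`, with `B`
expanded in matrix units so that only scalar product rules are needed. -/
theorem commutator_invariant_of_skew
    (B : Matrix (Fin n) (Fin n) ℂ →ₗ[ℂ] Matrix (Fin n) (Fin n) ℂ →ₗ[ℂ] ℂ)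
    (hB : ∀ u ∈ Matrix.unitaryGroup (Fin n) ℂ, ∀ X Y, B (u * X * uᴴ) (u * Y * uᴴ) = B X Y)
    {a : Matrix (Fin n) (Fin n) ℂ} (ha : aᴴ = -a) (X Y : Matrix (Fin n) (Fin n) ℂ) :
    B (a * X - X * a) Y + B X (a * Y - Y * a) = 0 := by
  have hX := fun i j => hasDerivAt_pi.1 (hasDerivAt_pi.1 (hasDerivAt_exp_conj a X) i) j
  have hY := fun i j => hasDerivAt_pi.1 (hasDerivAt_pi.1 (hasDerivAt_exp_conj a Y) i) j
  have h1 := HasDerivAt.fun_sum (u := Finset.univ) fun i _ =>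
    HasDerivAt.fun_sum (u := Finset.univ) fun j _ =>
      HasDerivAt.fun_sum (u := Finset.univ) fun k _ =>
        HasDerivAt.fun_sum (u := Finset.univ) fun l _ => (hX i j).fun_mul
          ((hY k l).mul_const (B (Matrix.single i j 1) (Matrix.single k l 1)))
  simp only [Finset.sum_add_distrib, ← bilin_eq_sum, zero_smul, NormedSpace.exp_zero, one_mul,
    mul_one] at h1
  have h2 : (fun t : ℝ => B (NormedSpace.exp (t • a) * X * NormedSpace.exp (t • -a))
      (NormedSpace.exp (t • a) * Y * NormedSpace.exp (t • -a))) = fun _ => B X Y := by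
    funext t
    rw [← (exp_unitary ha t).1, hB _ (exp_unitary ha t).2]
  rw [h2] at h1
  exact h1.unique (hasDerivAt_const _ _)

end

/-- The condition is complex linear in `a`, and every matrix is a complex combination of two
skew-Hermitian ones. -/
theorem commutator_invariant_of_unitary_invariant
    (B : Matrix (Fin n) (Fin n) ℂ →ₗ[ℂ] Matrix (Fin n) (Fin n) ℂ →ₗ[ℂ] ℂ)
    (hB : ∀ u ∈ Matrix.unitaryGroup (Fin n) ℂ, ∀ X Y, B (u * X * uᴴ) (u * Y * uᴴ) = B X Y)
    (a X Y : Matrix (Fin n) (Fin n) ℂ) :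
    B (a * X - X * a) Y + B X (a * Y - Y * a) = 0 := by
  have hs : (a - aᴴ)ᴴ = -(a - aᴴ) := by simp
  have ht : (I • (a + aᴴ))ᴴ = -(I • (a + aᴴ)) := by
    rw [Matrix.conjTranspose_smul]
    simp [add_comm]
  have h1 := commutator_invariant_of_skew B hB hs X Y
  have h2 := commutator_invariant_of_skew B hB ht X Y
  have hdec : a = (1 / 2 : ℂ) • (a - aᴴ) + (-(I / 2)) • (I • (a + aᴴ)) := by
    rw [smul_smul, show -(I / 2) * I = (1 / 2 : ℂ) by linear_combination (-1 / 2 : ℂ) * I_mul_I]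
    module
  generalize a - aᴴ = s at *
  generalize I • (a + aᴴ) = t at *
  subst hdec
  have e : ∀ Z : Matrix (Fin n) (Fin n) ℂ, ((1 / 2 : ℂ) • s + (-(I / 2)) • t) * Z -
      Z * ((1 / 2 : ℂ) • s + (-(I / 2)) • t) =
      (1 / 2 : ℂ) • (s * Z - Z * s) + (-(I / 2)) • (t * Z - Z * t) := by
    intro Z
    simp only [add_mul, mul_add, smul_mul_assoc, mul_smul_comm, smul_sub]
    abel
  rw [e, e, map_add, map_add, map_smul, map_smul, map_smul, map_smul, LinearMap.add_apply,
    LinearMap.smul_apply, LinearMap.smul_apply]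
  simp only [smul_eq_mul]
  linear_combination (1 / 2 : ℂ) * h1 + (-(I / 2)) * h2

/-- A unitary matrix acts by conjugation like an element of `SU(n)`. -/
theorem exists_su_conj_eq (hn : n ≠ 0) {u : Matrix (Fin n) (Fin n) ℂ}
    (hu : u ∈ Matrix.unitaryGroup (Fin n) ℂ) : ∃ v : SU n, ∀ X : Matrix (Fin n) (Fin n) ℂ,
      u * X * uᴴ = (v : Matrix (Fin n) (Fin n) ℂ) * X * (v : Matrix (Fin n) (Fin n) ℂ)ᴴ := by
  -- An `n`-th root of the conjugate of `det u` rescales `u` to determinant one, and the phase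
  -- cancels under conjugation.
  obtain ⟨z, hz⟩ := IsAlgClosed.exists_pow_nat_eq (star u.det) (Nat.pos_of_ne_zero hn)
  have hdet : u.det * star u.det = 1 := by
    have h := congrArg Matrix.det (Matrix.mem_unitaryGroup_iff.1 hu)
    rwa [Matrix.det_mul, Matrix.star_eq_conjTranspose, Matrix.det_conjTranspose,
      Matrix.det_one] at h
  have hnorm : ‖z‖ = 1 := by
    have h1 : ‖u.det‖ = 1 := by
      have h := congrArg norm hdet
      rw [norm_mul, norm_star, norm_one] at h
      nlinarith [norm_nonneg u.det]
    have h2 := congrArg norm hz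
    rw [norm_pow, norm_star, h1] at h2
    exact (pow_eq_one_iff_of_nonneg (norm_nonneg z) hn).1 h2
  have hzz : z * star z = 1 := by
    have := Complex.mul_conj z
    rw [Complex.normSq_eq_norm_sq, hnorm] at this
    simpa using this
  have hv : z • u ∈ Matrix.specialUnitaryGroup (Fin n) ℂ := by
    refine Matrix.mem_specialUnitaryGroup_iff.2 ⟨Matrix.mem_unitaryGroup_iff.2 ?_, ?_⟩
    · rw [star_smul, smul_mul_smul_comm, hzz, Matrix.mem_unitaryGroup_iff.1 hu, one_smul]
    · rw [Matrix.det_smul, Fintype.card_fin, hz, mul_comm, hdet]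
  refine ⟨⟨z • u, hv⟩, fun X => ?_⟩
  simp only [Matrix.conjTranspose_smul, smul_mul_assoc, mul_smul_comm, smul_smul]
  rw [mul_comm, hzz, one_smul]

/-! ## Moments of the Haar measure of `SU(n)` -/

instance (n : ℕ) : IsProbabilityMeasure (haarSU n) :=
  ⟨by
    have := Measure.haarMeasure_self (K₀ := (⊤ : TopologicalSpace.PositiveCompacts (SU n)))
    simpa [haarSU] using this⟩

instance (n : ℕ) : (haarSU n).IsMulLeftInvariant :=
  Measure.isMulLeftInvariant_haarMeasure _

instance (n : ℕ) : SecondCountableTopology (SU n) :=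
  haveI : SecondCountableTopology (Matrix (Fin n) (Fin n) ℂ) :=
    inferInstanceAs (SecondCountableTopology (Fin n → Fin n → ℂ))
  inferInstanceAs (SecondCountableTopology
    ((Matrix.specialUnitaryGroup (Fin n) ℂ : Set (Matrix (Fin n) (Fin n) ℂ))))

theorem integrable_of_continuous {f : SU n → ℂ} (hf : Continuous f) :
    Integrable f (haarSU n) :=
  hf.integrable_of_hasCompactSupport (HasCompactSupport.of_compactSpace f)

/-- The adjoint action of `SU(n)` on matrices. -/
def adj (g : SU n) (y : Matrix (Fin n) (Fin n) ℂ) : Matrix (Fin n) (Fin n) ℂ :=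
  (g : Matrix (Fin n) (Fin n) ℂ) * y * (g : Matrix (Fin n) (Fin n) ℂ)ᴴ

theorem su_conjTranspose_mul_self (g : SU n) :
    (g : Matrix (Fin n) (Fin n) ℂ)ᴴ * (g : Matrix (Fin n) (Fin n) ℂ) = 1 :=
  Matrix.mem_unitaryGroup_iff'.1 (Matrix.mem_specialUnitaryGroup_iff.1 g.2).1

theorem trace_adj (g : SU n) (y : Matrix (Fin n) (Fin n) ℂ) : (adj g y).trace = y.trace := by
  rw [adj, Matrix.trace_mul_comm, ← mul_assoc, su_conjTranspose_mul_self, one_mul]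

theorem adj_mul_adj (g : SU n) (x y : Matrix (Fin n) (Fin n) ℂ) :
    adj g x * adj g y = adj g (x * y) := by
  simp only [adj]
  calc _ = (g : Matrix (Fin n) (Fin n) ℂ) * x * ((g : Matrix (Fin n) (Fin n) ℂ)ᴴ *
        (g : Matrix (Fin n) (Fin n) ℂ)) * y * (g : Matrix (Fin n) (Fin n) ℂ)ᴴ := by
        noncomm_ring
    _ = _ := by rw [su_conjTranspose_mul_self]; noncomm_ring

/-- Moves a conjugation of the test matrix onto the Haar variable, where left invariance removes it.
-/
theorem trace_conj_mul_adj (v g : SU n) (X y : Matrix (Fin n) (Fin n) ℂ) :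
    (adj v X * adj g y).trace = (X * adj (v⁻¹ * g) y).trace := by
  have h : ((v⁻¹ : SU n) : Matrix (Fin n) (Fin n) ℂ) = (v : Matrix (Fin n) (Fin n) ℂ)ᴴ := rfl
  simp only [adj, Submonoid.coe_mul, h, Matrix.conjTranspose_mul,
    Matrix.conjTranspose_conjTranspose]
  simp only [mul_assoc]
  rw [Matrix.trace_mul_comm]
  simp only [mul_assoc]

theorem continuous_adj (y : Matrix (Fin n) (Fin n) ℂ) : Continuous fun g : SU n => adj g y := by
  unfold adj
  fun_prop

theorem continuous_trace_adj (X y : Matrix (Fin n) (Fin n) ℂ) :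
    Continuous fun g : SU n => (X * adj g y).trace :=
  (continuous_const.mul (continuous_adj y)).matrix_trace

/-- The second moment form of the adjoint orbit of `y`. -/
def secondMoment (y : Matrix (Fin n) (Fin n) ℂ) :
    Matrix (Fin n) (Fin n) ℂ →ₗ[ℂ] Matrix (Fin n) (Fin n) ℂ →ₗ[ℂ] ℂ :=
  LinearMap.mk₂ ℂ (fun X Y => ∫ g, (X * adj g y).trace * (Y * adj g y).trace ∂haarSU n)
    (fun X X' Y => by
      simp only [add_mul, Matrix.trace_add]
      exact integral_add
        (integrable_of_continuous ((continuous_trace_adj X y).mul (continuous_trace_adj Y y)))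
        (integrable_of_continuous ((continuous_trace_adj X' y).mul (continuous_trace_adj Y y))))
    (fun c X Y => by
      simp only [smul_mul_assoc, Matrix.trace_smul, smul_eq_mul, mul_assoc]
      exact integral_const_mul _ _)
    (fun X Y Y' => by
      simp only [add_mul, mul_add, Matrix.trace_add]
      exact integral_add
        (integrable_of_continuous ((continuous_trace_adj X y).mul (continuous_trace_adj Y y)))
        (integrable_of_continuous ((continuous_trace_adj X y).mul (continuous_trace_adj Y' y))))
    (fun c X Y => by
      simp only [smul_mul_assoc, Matrix.trace_smul, smul_eq_mul, mul_left_comm _ c]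
      exact integral_const_mul _ _)

theorem secondMoment_apply (y X Y : Matrix (Fin n) (Fin n) ℂ) : secondMoment y X Y =
    ∫ g, (X * adj g y).trace * (Y * adj g y).trace ∂haarSU n := rfl

/-- The first moment form of the adjoint orbit of `y`. -/
def firstMoment (y : Matrix (Fin n) (Fin n) ℂ) : Matrix (Fin n) (Fin n) ℂ →ₗ[ℂ] ℂ where
  toFun X := ∫ g, (X * adj g y).trace ∂haarSU n
  map_add' X X' := by
    simp only [add_mul, Matrix.trace_add]
    exact integral_add (integrable_of_continuous (continuous_trace_adj X y))
      (integrable_of_continuous (continuous_trace_adj X' y))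
  map_smul' c X := by
    simp only [smul_mul_assoc, Matrix.trace_smul, smul_eq_mul]
    exact integral_const_mul _ _

theorem exists_secondMoment_eq (hn : 2 ≤ n) (y : Matrix (Fin n) (Fin n) ℂ) :
    ∃ α β : ℂ, ∀ X Y, secondMoment y X Y = α * (X.trace * Y.trace) + β * (X * Y).trace := by
  refine eq_trace_of_commutator_invariant hn _
    (commutator_invariant_of_unitary_invariant _ fun u hu X Y => ?_)
  obtain ⟨v, hv⟩ := exists_su_conj_eq (by omega) hu
  rw [hv X, hv Y, secondMoment_apply, secondMoment_apply]
  change ∫ g, (adj v X * adj g y).trace * (adj v Y * adj g y).trace ∂haarSU n = _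
  simp only [trace_conj_mul_adj]
  exact integral_mul_left_eq_self (fun g => (X * adj g y).trace * (Y * adj g y).trace) v⁻¹

theorem integral_trace_adj (hn : 2 ≤ n) {y : Matrix (Fin n) (Fin n) ℂ} (hy : y.trace = 0)
    (X : Matrix (Fin n) (Fin n) ℂ) : ∫ g, (X * adj g y).trace ∂haarSU n = 0 := by
  have hn0 : (n : ℂ) ≠ 0 := Nat.cast_ne_zero.2 (by omega)
  -- Multiplying the first moment by `Tr Y` makes it an invariant bilinear form, so the same
  -- classification applies. Setting `Y = 1` shows that the first moment is a multiple of the trace,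
  -- and `X = 1` shows that this multiple is zero.
  obtain ⟨α, β, h⟩ := eq_trace_of_commutator_invariant hn
    ((firstMoment y).smulRight (Matrix.traceLinearMap (Fin n) ℂ ℂ))
    (commutator_invariant_of_unitary_invariant _ fun u hu X Y => by
      obtain ⟨v, hv⟩ := exists_su_conj_eq (by omega) hu
      rw [hv X, hv Y]
      change firstMoment y (adj v X) * (adj v Y).trace = firstMoment y X * Y.trace
      rw [trace_adj]
      congr 1
      change ∫ g, (adj v X * adj g y).trace ∂haarSU n = ∫ g, (X * adj g y).trace ∂haarSU n
      simp only [trace_conj_mul_adj]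
      exact integral_mul_left_eq_self (fun g => (X * adj g y).trace) v⁻¹)
  have h1 : ∀ X, firstMoment y X * n = (α * n + β) * X.trace := by
    intro X
    have := h X 1
    simp only [LinearMap.smulRight_apply, LinearMap.smul_apply, Matrix.traceLinearMap_apply,
      Matrix.trace_one, Fintype.card_fin, mul_one, smul_eq_mul] at this
    linear_combination this
  have h2 : firstMoment y 1 = 0 := by
    change ∫ g, (1 * adj g y).trace ∂haarSU n = 0
    simp [trace_adj, hy]
  have h3 := h1 1
  rw [h2, zero_mul, Matrix.trace_one, Fintype.card_fin] at h3
  have h4 : α * n + β = 0 := (mul_eq_zero.1 h3.symm).resolve_right hn0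
  have h5 := h1 X
  rw [h4, zero_mul] at h5
  exact (mul_eq_zero.1 h5).resolve_right hn0

/-- The families `E_ij` and `E_ji` are dual bases for the trace form. -/
theorem sum_trace_single_mul (x y : Matrix (Fin n) (Fin n) ℂ) :
    ∑ i, ∑ j, (Matrix.single i j 1 * x).trace * (Matrix.single j i 1 * y).trace =
      (x * y).trace := by
  simp only [Matrix.trace_single_mul, one_mul, smul_eq_mul]
  simp only [Matrix.trace, Matrix.diag, Matrix.mul_apply]
  exact Finset.sum_comm

/-- Two contractions fix the coefficients `α`, `β` of the invariant form: the pair `(1, 1)` gives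
`0` because `y` is traceless, and the dual bases `E_ij`, `E_ji` give `Tr(y²)`. -/
theorem integral_trace_adj_mul_trace_adj (hn : 2 ≤ n) {y : Matrix (Fin n) (Fin n) ℂ}
    (hy : y.trace = 0) (X Y : Matrix (Fin n) (Fin n) ℂ) :
    ∫ g, (X * adj g y).trace * (Y * adj g y).trace ∂haarSU n =
      (y * y).trace / ((n : ℂ) ^ 2 - 1) * ((X * Y).trace - X.trace * Y.trace / n) := by
  have hn0 : (n : ℂ) ≠ 0 := Nat.cast_ne_zero.2 (by omega)
  have hn1 : (n : ℂ) ^ 2 - 1 ≠ 0 := by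
    rw [sub_ne_zero]
    exact_mod_cast (Nat.one_lt_pow two_ne_zero hn).ne'
  obtain ⟨α, β, h⟩ := exists_secondMoment_eq hn y
  have h1 : n * α + β = 0 := by
    have e1 := h 1 1
    have e2 : secondMoment y 1 1 = 0 := by
      rw [secondMoment_apply]
      simp [trace_adj, hy]
    rw [e2, one_mul, Matrix.trace_one, Fintype.card_fin] at e1
    refine (mul_eq_zero.1 (?_ : (n : ℂ) * (n * α + β) = 0)).resolve_left hn0
    linear_combination -e1
  have h2 : n * α + (n : ℂ) ^ 2 * β = (y * y).trace := by
    have e1 : ∑ i : Fin n, ∑ j : Fin n,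
        secondMoment y (Matrix.single i j 1) (Matrix.single j i 1) = (y * y).trace := by
      simp only [secondMoment_apply]
      have hint : ∀ i j : Fin n, Integrable (fun g => (Matrix.single i j 1 * adj g y).trace *
          (Matrix.single j i 1 * adj g y).trace) (haarSU n) := fun i j =>
        integrable_of_continuous ((continuous_trace_adj _ y).mul (continuous_trace_adj _ y))
      simp only [← integral_finsetSum _ fun j _ => hint _ j]
      rw [← integral_finsetSum _ fun i _ => integrable_finsetSum _ fun j _ => hint i j]
      simp [sum_trace_single_mul, adj_mul_adj, trace_adj]
    rw [← e1]
    simp only [h]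
    simp only [Matrix.single_mul_single_same, mul_one, trace_single_one, if_true]
    simp [Finset.sum_add_distrib]
    ring
  rw [← secondMoment_apply, h]
  have hα : α = -β / n := by
    field_simp
    linear_combination h1
  have hβ : β * ((n : ℂ) ^ 2 - 1) = (y * y).trace := by
    linear_combination h2 - h1
  rw [← hβ, hα]
  field_simp
  ring

/-! ## The variance of the abstracted gradient -/

/-- The quadratic Casimir in the adjoint representation: the cross terms sum to `2 (Tr h)² = 0`, and
the two square terms contribute `n Tr(h²)` each. -/
theorem sum_trace_commutator_single (h : Matrix (Fin n) (Fin n) ℂ) (hh : h.trace = 0) :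
    ∑ i, ∑ j, ((Matrix.single i j 1 * h - h * Matrix.single i j 1) *
      (Matrix.single j i 1 * h - h * Matrix.single j i 1)).trace = -(2 * n * (h * h).trace) := by
  have key : ∀ i j : Fin n, ((Matrix.single i j 1 * h - h * Matrix.single i j 1) *
      (Matrix.single j i 1 * h - h * Matrix.single j i 1)).trace =
      2 * (h i i * h j j) - (h * h) j j - (h * h) i i := by
    intro i j
    have e : (Matrix.single i j 1 * h - h * Matrix.single i j 1) *
        (Matrix.single j i 1 * h - h * Matrix.single j i 1) =
        Matrix.single i j 1 * h * Matrix.single j i 1 * h -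
          Matrix.single i j 1 * (h * h) * Matrix.single j i 1 -
          h * (Matrix.single i j 1 * Matrix.single j i 1) * h +
          h * (Matrix.single i j 1 * h * Matrix.single j i 1) := by noncomm_ring
    have e1 : Matrix.single i j 1 * h * Matrix.single j i 1 = Matrix.single i i (h j j) := by
      simp
    have e2 : Matrix.single i j 1 * (h * h) * Matrix.single j i 1 =
        Matrix.single i i ((h * h) j j) := by simp
    rw [e, e2, e1, Matrix.single_mul_single_same, Matrix.trace_add, Matrix.trace_sub,
      Matrix.trace_sub, Matrix.trace_mul_comm (h * _) h, ← mul_assoc,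
      Matrix.trace_mul_comm (h * h), Matrix.trace_mul_comm h]
    simp only [Matrix.trace_single_mul, Matrix.trace_single_eq_same, smul_eq_mul, one_mul]
    ring
  have ht : ∑ i, h i i = 0 := hh
  have ht2 : ∑ i, (h * h) i i = (h * h).trace := rfl
  simp only [key, Finset.sum_sub_distrib, ← Finset.mul_sum, ht, ht2, Finset.sum_const,
    Finset.card_univ, Fintype.card_fin, nsmul_eq_mul]
  simp only [mul_zero, Finset.sum_const_zero]
  ring

theorem natCast_sq_sub_one_ne_zero (hn : 2 ≤ n) : (n : ℂ) ^ 2 - 1 ≠ 0 := by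
  rw [sub_ne_zero]
  exact_mod_cast (Nat.one_lt_pow two_ne_zero hn).ne'

/-- The average Casimir value of a commutator with a Haar random element of an adjoint orbit. -/
theorem integral_trace_commutator_sq (hn : 2 ≤ n) {o h : Matrix (Fin n) (Fin n) ℂ}
    (ho : o.trace = 0) (hh : h.trace = 0) :
    ∫ g, ((h * adj g o - adj g o * h) * (h * adj g o - adj g o * h)).trace ∂haarSU n =
      -(2 * n * (o * o).trace * (h * h).trace / ((n : ℂ) ^ 2 - 1)) := by
  have e0 : ∀ (i j : Fin n) (X : Matrix (Fin n) (Fin n) ℂ),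
      (Matrix.single i j 1 * (h * X - X * h)).trace =
      ((Matrix.single i j 1 * h - h * Matrix.single i j 1) * X).trace := by
    intro i j X
    rw [mul_sub, sub_mul, Matrix.trace_sub, Matrix.trace_sub, ← mul_assoc, ← mul_assoc,
      Matrix.trace_mul_comm _ h, ← mul_assoc]
  -- Expanding in dual bases and moving the commutator onto `E_ij` leaves products of two linear
  -- functionals of `X`, to which the second moment formula applies.
  have e1 : ∀ X : Matrix (Fin n) (Fin n) ℂ, ((h * X - X * h) * (h * X - X * h)).trace =
      ∑ i, ∑ j, ((Matrix.single i j 1 * h - h * Matrix.single i j 1) * X).trace *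
        ((Matrix.single j i 1 * h - h * Matrix.single j i 1) * X).trace := by
    intro X
    rw [← sum_trace_single_mul]
    simp only [e0]
  have e2 : ∀ i j : Fin n, (Matrix.single i j 1 * h - h * Matrix.single i j 1).trace = 0 := by
    intro i j
    rw [Matrix.trace_sub, Matrix.trace_mul_comm, sub_self]
  have hint : ∀ X Y : Matrix (Fin n) (Fin n) ℂ,
      Integrable (fun g => (X * adj g o).trace * (Y * adj g o).trace) (haarSU n) := fun X Y =>
    integrable_of_continuous ((continuous_trace_adj X o).mul (continuous_trace_adj Y o))
  simp only [e1]
  rw [integral_finsetSum _ fun i _ => integrable_finsetSum _ fun j _ => hint _ _]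
  simp only [integral_finsetSum _ fun j _ => hint _ _, integral_trace_adj_mul_trace_adj hn ho, e2,
    zero_mul, zero_div, sub_zero, ← Finset.mul_sum, sum_trace_commutator_single h hh]
  ring

/-- The projection of `ℂⁿ` onto the span of the `e_i`, `i ∈ S`. -/
def coordProj (S : Finset (Fin n)) : Matrix (Fin n) (Fin n) ℂ :=
  Matrix.diagonal fun i => if i ∈ S then 1 else 0

theorem trace_coordProj (S : Finset (Fin n)) : (coordProj S).trace = S.card := by
  simp [coordProj, Matrix.trace_diagonal]

theorem coordProj_mul_self (S : Finset (Fin n)) : coordProj S * coordProj S = coordProj S := by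
  simp [coordProj, Matrix.diagonal_mul_diagonal]

theorem trace_coordProj_mul (S : Finset (Fin n)) (a : Matrix (Fin n) (Fin n) ℂ) :
    (coordProj S * a).trace = ∑ i ∈ S, a i i := by
  simp [coordProj, Matrix.trace, Matrix.diagonal_mul]

/-- The abstracted gradient of a Lie algebra supported ansatz in terms of `n × n` matrices. -/
theorem absGrad_eq {o h : Matrix (Fin n) (Fin n) ℂ} {O H : Op n} (hO : I • O = dphi o)
    (hH : H = dphi h) (S : Finset (Fin n)) (gp gm : SU n) :
    absGrad (basisState S) O H gp gm =
      -I * (coordProj S * adj gm (h * adj gp o - adj gp o * h)).trace := by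
  have hO' : O = (-I) • dGamma o := by
    rw [← dphi_eq_dGamma, ← hO, smul_smul]
    simp
  have h1 : phi gp * O * (phi gp)ᴴ = (-I) • dGamma (adj gp o) := by
    rw [hO', mul_smul_comm, smul_mul_assoc]
    congr 1
    exact compound_conj_dGamma (su_conjTranspose_mul_self gp) o
  have h2 : H * (phi gp * O * (phi gp)ᴴ) - (phi gp * O * (phi gp)ᴴ) * H =
      (-I) • dGamma (h * adj gp o - adj gp o * h) := by
    rw [h1, hH, dphi_eq_dGamma, mul_smul_comm, smul_mul_assoc, ← smul_sub, dGamma_commutator]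
  have h3 : ∀ y, phi gm * dGamma y * (phi gm)ᴴ = dGamma (adj gm y) :=
    compound_conj_dGamma (su_conjTranspose_mul_self gm)
  rw [absGrad, h2, mul_smul_comm, Matrix.trace_smul, smul_eq_mul, trace_coordProj_mul,
    ← dGamma_diag, ← h3]
  congr 1
  rw [mul_assoc, mul_assoc, Matrix.trace_mul_comm, mul_assoc, basisState, Matrix.trace_single_mul,
    one_smul, mul_assoc]

theorem stdNormSq_eq {a : Matrix (Fin n) (Fin n) ℂ} (ha : a ∈ su n) :
    (stdNormSq a : ℂ) = -(a * a).trace := by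
  have h : star (-(a * a).trace) = -(a * a).trace := by
    rw [star_neg, ← Matrix.trace_conjTranspose, Matrix.conjTranspose_mul, ha.1, neg_mul_neg]
  exact Complex.conj_eq_iff_re.1 h

theorem continuous_adj_commutator (o h : Matrix (Fin n) (Fin n) ℂ) :
    Continuous fun g : SU n => h * adj g o - adj g o * h :=
  (continuous_const.mul (continuous_adj o)).sub ((continuous_adj o).mul continuous_const)

theorem continuous_absGrad {o h : Matrix (Fin n) (Fin n) ℂ} {O H : Op n} (hO : I • O = dphi o)
    (hH : H = dphi h) (S : Finset (Fin n)) :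
    Continuous fun p : SU n × SU n => absGrad (basisState S) O H p.1 p.2 := by
  simp only [absGrad_eq hO hH]
  refine continuous_const.mul (Continuous.matrix_trace (continuous_const.mul ?_))
  have h1 := (continuous_adj_commutator o h).comp (continuous_fst (X := SU n) (Y := SU n))
  have h2 : Continuous fun p : SU n × SU n => (p.2 : Matrix (Fin n) (Fin n) ℂ) :=
    continuous_subtype_val.comp continuous_snd
  exact (h2.mul h1).mul h2.matrix_conjTranspose

/-- The inner integral over `g₋` gives mean zero and a second moment proportional to `Tr [h, g₊ o
g₊†]²`; the outer integral over `g₊` is the Casimir average. The minus signs from `(-i)²` and from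
that average cancel. -/
theorem gradVar_eq (hn : 2 ≤ n) {o h : Matrix (Fin n) (Fin n) ℂ} (ho : o ∈ su n) (hh : h ∈ su n)
    {O H : Op n} (hO : I • O = dphi o) (hH : H = dphi h) (S : Finset (Fin n)) :
    gradVar (basisState S) O H = 2 * stdNormSq o * stdNormSq h *
      ((S.card : ℝ) * ((n : ℝ) - S.card)) / ((n : ℝ) ^ 2 - 1) ^ 2 := by
  have hn0 : (n : ℂ) ≠ 0 := Nat.cast_ne_zero.2 (by omega)
  have hn1 := natCast_sq_sub_one_ne_zero hn
  have hcont := continuous_absGrad hO hH S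
  -- The moments are known as complex integrals, so the real part must be identified with the
  -- gradient itself.
  have hreal : ∀ p : SU n × SU n, ((absGrad (basisState S) O H p.1 p.2).re : ℂ) =
      absGrad (basisState S) O H p.1 p.2 := by
    intro p
    refine Complex.ext rfl ?_
    rw [Complex.ofReal_im, absGrad_im]
    · simp [basisState, Matrix.conjTranspose_single]
    · have hO' : O = (-I) • dGamma o := by
        rw [← dphi_eq_dGamma, ← hO, smul_smul]
        simp
      rw [hO', Matrix.conjTranspose_smul, dGamma_conjTranspose, ho.1, map_neg]
      simp
    · rw [hH, dphi_eq_dGamma, dGamma_conjTranspose, hh.1, map_neg]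
  have hintC : ∀ f : SU n × SU n → ℂ, Continuous f →
      Integrable f ((haarSU n).prod (haarSU n)) := fun f hf =>
    hf.integrable_of_hasCompactSupport (HasCompactSupport.of_compactSpace f)
  have hmem : MemLp (fun p : SU n × SU n => (absGrad (basisState S) O H p.1 p.2).re) 2
      ((haarSU n).prod (haarSU n)) :=
    (Complex.continuous_re.comp hcont).memLp_of_hasCompactSupport
      (HasCompactSupport.of_compactSpace _)
  have hy : ∀ g, (h * adj g o - adj g o * h).trace = 0 := by
    intro g
    rw [Matrix.trace_sub, Matrix.trace_mul_comm, sub_self]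
  have hmean : ∫ p, (absGrad (basisState S) O H p.1 p.2).re ∂((haarSU n).prod (haarSU n)) = 0 := by
    rw [← Complex.ofReal_eq_zero, ← integral_complex_ofReal]
    simp only [hreal]
    rw [integral_prod _ (hintC _ hcont)]
    simp only [absGrad_eq hO hH, integral_const_mul, integral_trace_adj hn (hy _), mul_zero,
      integral_zero]
  have hsq : ∫ p, (absGrad (basisState S) O H p.1 p.2).re ^ 2 ∂((haarSU n).prod (haarSU n)) =
      2 * stdNormSq o * stdNormSq h *
        ((S.card : ℝ) * ((n : ℝ) - S.card)) / ((n : ℝ) ^ 2 - 1) ^ 2 := by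
    rw [← Complex.ofReal_inj, ← integral_complex_ofReal]
    simp only [Complex.ofReal_pow, hreal]
    rw [integral_prod (fun p : SU n × SU n => absGrad (basisState S) O H p.1 p.2 ^ 2)
      (hintC _ (hcont.pow 2))]
    have e : ∀ gp gm : SU n, absGrad (basisState S) O H gp gm ^ 2 =
        -((coordProj S * adj gm (h * adj gp o - adj gp o * h)).trace *
          (coordProj S * adj gm (h * adj gp o - adj gp o * h)).trace) := by
      intro gp gm
      rw [absGrad_eq hO hH, mul_pow, neg_sq, I_sq]
      ring
    simp only [e, integral_neg, integral_trace_adj_mul_trace_adj hn (hy _), coordProj_mul_self,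
      trace_coordProj, integral_mul_const, integral_div,
      integral_trace_commutator_sq hn ho.2 hh.2]
    push_cast
    rw [stdNormSq_eq ho, stdNormSq_eq hh]
    field_simp
  rw [gradVar, variance_eq_sub hmem, hmean]
  simp only [Pi.pow_apply]
  rw [hsq]
  ring

/-! ## Asymptotics -/

theorem one_div_le_weight_div (hn : 2 ≤ n) {k : ℕ} (hk : 1 ≤ k) (hk' : k ≤ n - 1) :
    1 / (2 * (n : ℝ) ^ 3) ≤ ((k : ℝ) * ((n : ℝ) - k)) / ((n : ℝ) ^ 2 - 1) ^ 2 := by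
  have h1 : (2 : ℝ) ≤ n := by exact_mod_cast hn
  have h2 : (1 : ℝ) ≤ k := by exact_mod_cast hk
  have h3 : (k : ℝ) + 1 ≤ n := by exact_mod_cast (by omega : k + 1 ≤ n)
  -- The difference of the two sides is `(k-1)(n-k-1)`.
  have h4 : (n : ℝ) - 1 ≤ (k : ℝ) * ((n : ℝ) - k) := by nlinarith
  have h5 : (0 : ℝ) < (n : ℝ) ^ 2 - 1 := by nlinarith
  rw [div_le_div_iff₀ (by positivity) (by positivity), one_mul]
  -- The factor `2` is a margin: `(n-1)(n+1)²` exceeds `n³` for `n ≥ 2`, but not `2n³`.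
  have h6 : ((n : ℝ) ^ 2 - 1) ^ 2 ≤ ((n : ℝ) - 1) * (2 * (n : ℝ) ^ 3) := by
    have h7 : ((n : ℝ) - 1) * (2 * (n : ℝ) ^ 3) - ((n : ℝ) ^ 2 - 1) ^ 2 =
        ((n : ℝ) - 1) * ((n : ℝ) ^ 2 * ((n : ℝ) - 1) + n + 1) := by ring
    have h8 : 0 ≤ ((n : ℝ) - 1) * ((n : ℝ) ^ 2 * ((n : ℝ) - 1) + n + 1) :=
      mul_nonneg (by linarith) (by nlinarith [sq_nonneg (n : ℝ)])
    linarith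
  exact h6.trans (mul_le_mul_of_nonneg_right h4 (by positivity))

/-- A sequence that is bounded below by a multiple of `1 / n ^ 3` is in `Ω(1 / n ^ 3)` and does not
decay exponentially. -/
theorem no_barren_plateau {V : ℕ → ℝ} {c : ℝ} (hc : 0 < c)
    (hV : ∀ n : ℕ, 2 ≤ n → c / (n : ℝ) ^ 3 ≤ V n) :
    ((fun n : ℕ => 1 / (n : ℝ) ^ 3) =O[atTop] V) ∧
      ¬ ∃ b : ℝ, 1 < b ∧ V =O[atTop] fun n : ℕ => 1 / b ^ n := by
  have h1 : (fun n : ℕ => 1 / (n : ℝ) ^ 3) =O[atTop] V := by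
    refine IsBigO.of_bound c⁻¹ ?_
    filter_upwards [eventually_ge_atTop 2] with n hn
    have h2 := hV n hn
    have h3 : 0 ≤ c / (n : ℝ) ^ 3 := by positivity
    rw [Real.norm_of_nonneg (by positivity), Real.norm_of_nonneg (h3.trans h2), inv_mul_eq_div,
      le_div_iff₀ hc]
    calc 1 / (n : ℝ) ^ 3 * c = c / (n : ℝ) ^ 3 := by ring
      _ ≤ V n := h2
  refine ⟨h1, ?_⟩
  rintro ⟨b, hb, h2⟩
  have h3 : (fun n : ℕ => 1 / b ^ n) =o[atTop] fun n : ℕ => 1 / (n : ℝ) ^ 3 := by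
    refine (isLittleO_iff_tendsto' ?_).2 ?_
    · filter_upwards [eventually_ge_atTop 1] with n hn h
      have : (0 : ℝ) < n := by exact_mod_cast hn
      have : 0 < 1 / (n : ℝ) ^ 3 := by positivity
      exact absurd h this.ne'
    · refine (tendsto_pow_const_div_const_pow_of_one_lt 3 hb).congr fun n => ?_
      rw [one_div, one_div, div_inv_eq_mul, inv_mul_eq_div]
  refine isLittleO_irrefl (Eventually.frequently ?_) (h1.trans_isLittleO (h2.trans_isLittleO h3))
  filter_upwards [eventually_ge_atTop 1] with n hn
  have : (0 : ℝ) < n := by exact_mod_cast hn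
  positivity

theorem gradVar_hz_eq (hn : 2 ≤ n) {i j : Fin n} (hij : i < j) {H : Op n}
    (hH : H ∈ generators n) (S : Finset (Fin n)) :
    gradVar (basisState S) (I • hz i j) H =
      ((S.card : ℝ) * ((n : ℝ) - S.card)) / (2 * ((n : ℝ) ^ 2 - 1) ^ 2) := by
  obtain ⟨o, ho, hO, hno⟩ := exists_su_of_hz hij
  obtain ⟨h, hh, hHh, hnh⟩ := exists_su_of_mem_generators hH
  rw [gradVar_eq hn ho hh hO (hHh.trans (dphi_eq_dGamma h).symm), hno, hnh,
    mul_comm (2 : ℝ) (((n : ℝ) ^ 2 - 1) ^ 2), ← div_div]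
  ring

/-- The `2` in the exact variance cancels the `2` in `one_div_le_weight_div`, leaving the constant
`δ²`; for `i h_z` and a generator, `δ = 1/2` gives `1/4`. -/
theorem le_gradVar (hn : 2 ≤ n) {o h : Matrix (Fin n) (Fin n) ℂ} (ho : o ∈ su n)
    (hh : h ∈ su n) {O H : Op n} (hO : I • O = dphi o) (hH : H = dphi h) {S : Finset (Fin n)}
    (hS : 1 ≤ S.card) (hS' : S.card ≤ n - 1) {δ : ℝ} (hδ : 0 < δ) (hδo : δ ≤ stdNormSq o)
    (hδh : δ ≤ stdNormSq h) : δ ^ 2 / (n : ℝ) ^ 3 ≤ gradVar (basisState S) O H := by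
  have h1 := one_div_le_weight_div hn hS hS'
  have h2 : δ ^ 2 ≤ stdNormSq o * stdNormSq h := by
    rw [sq]
    exact mul_le_mul hδo hδh hδ.le (hδ.le.trans hδo)
  have h3 : (0 : ℝ) < n := by exact_mod_cast (by omega : 0 < n)
  have h4 := mul_le_mul h2 h1 (by positivity) ((sq_nonneg δ).trans h2)
  rw [gradVar_eq hn ho hh hO hH]
  calc δ ^ 2 / (n : ℝ) ^ 3 = 2 * (δ ^ 2 * (1 / (2 * (n : ℝ) ^ 3))) := by field_simp
    _ ≤ 2 * _ := mul_le_mul_of_nonneg_left h4 zero_le_two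
    _ = _ := by ring

theorem le_gradVar_hz (hn : 2 ≤ n) {i j : Fin n} (hij : i < j) {H : Op n}
    (hH : H ∈ generators n) {S : Finset (Fin n)} (hS : 1 ≤ S.card) (hS' : S.card ≤ n - 1) :
    (1 / 4) / (n : ℝ) ^ 3 ≤ gradVar (basisState S) (I • hz i j) H := by
  obtain ⟨o, ho, hO, hno⟩ := exists_su_of_hz hij
  obtain ⟨h, hh, hHh, hnh⟩ := exists_su_of_mem_generators hH
  have := le_gradVar hn ho hh hO (hHh.trans (dphi_eq_dGamma h).symm) hS hS' one_half_pos hno.ge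
    hnh.ge
  norm_num at this ⊢
  exact this

end Compound
end

/-! ### The main theorem -/

theorem theorem5 :
    -- the dynamical Lie algebra is the image of `𝔰𝔲(n)`, and `i h_z^{12}` is supported on it
    (∀ (n : ℕ) (hn : 2 ≤ n),
      (Compound.dla (Compound.generators n) : Set (Compound.Op n)) =
          Compound.dphi '' Compound.su n ∧
      Compound.IsLASA (Compound.generators n)
        (I • Compound.hz (⟨0, by omega⟩ : Fin n) ⟨1, by omega⟩)) ∧
    -- exact variance for an arbitrary observable `O = -i dφ(o)` and direction `H = dφ(h)`
    (∀ n : ℕ, 2 ≤ n → ∀ o ∈ Compound.su n, ∀ h ∈ Compound.su n, ∀ O H : Compound.Op n,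
      I • O = Compound.dphi o → H = Compound.dphi h → ∀ S : Finset (Fin n),
        Compound.gradVar (Compound.basisState S) O H =
          2 * Compound.stdNormSq o * Compound.stdNormSq h * ((S.card : ℝ) * ((n : ℝ) - S.card)) /
            ((n : ℝ) ^ 2 - 1) ^ 2) ∧
    -- exact variance for the observable `i h_z^{12}` and any generator `H`
    (∀ (n : ℕ) (hn : 2 ≤ n), ∀ H ∈ Compound.generators n, ∀ S : Finset (Fin n),
      Compound.gradVar (Compound.basisState S)
          (I • Compound.hz (⟨0, by omega⟩ : Fin n) ⟨1, by omega⟩) H =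
        ((S.card : ℝ) * ((n : ℝ) - S.card)) / (2 * ((n : ℝ) ^ 2 - 1) ^ 2)) ∧
    -- `Ω(1/n³)`, uniformly in the generator and in the basis state of weight `1 ≤ k ≤ n - 1`
    (∃ c : ℝ, 0 < c ∧ ∀ (n : ℕ) (hn : 2 ≤ n), ∀ H ∈ Compound.generators n,
      ∀ S : Finset (Fin n), 1 ≤ S.card → S.card ≤ n - 1 →
        c / (n : ℝ) ^ 3 ≤ Compound.gradVar (Compound.basisState S)
          (I • Compound.hz (⟨0, by omega⟩ : Fin n) ⟨1, by omega⟩) H) ∧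
    -- `Ω(1/n³)` and no barren plateau for every family of Lie algebra supported observables and
    -- directions whose standard norms are bounded below
    (∀ (o h : ∀ n, Matrix (Fin n) (Fin n) ℂ) (O H : ∀ n, Compound.Op n)
      (S : ∀ n, Finset (Fin n)) (δ : ℝ), 0 < δ →
      (∀ n, 2 ≤ n → o n ∈ Compound.su n ∧ h n ∈ Compound.su n ∧
        I • O n = Compound.dphi (o n) ∧ H n = Compound.dphi (h n) ∧
        δ ≤ Compound.stdNormSq (o n) ∧ δ ≤ Compound.stdNormSq (h n) ∧
        1 ≤ (S n).card ∧ (S n).card ≤ n - 1) →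
      ((fun n : ℕ => 1 / (n : ℝ) ^ 3) =O[atTop]
          fun n => Compound.gradVar (Compound.basisState (S n)) (O n) (H n)) ∧
      ¬ ∃ b : ℝ, 1 < b ∧
        (fun n => Compound.gradVar (Compound.basisState (S n)) (O n) (H n)) =O[atTop]
          fun n : ℕ => 1 / b ^ n) ∧
    -- in particular no barren plateau for the observable `i h_z^{12}`
    (∀ (O H : ∀ n, Compound.Op n) (S : ∀ n, Finset (Fin n)),
      (∀ (n : ℕ) (hn : 2 ≤ n),
        O n = I • Compound.hz (⟨0, by omega⟩ : Fin n) ⟨1, by omega⟩ ∧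
        H n ∈ Compound.generators n ∧ 1 ≤ (S n).card ∧ (S n).card ≤ n - 1) →
      ((fun n : ℕ => 1 / (n : ℝ) ^ 3) =O[atTop]
          fun n => Compound.gradVar (Compound.basisState (S n)) (O n) (H n)) ∧
      ¬ ∃ b : ℝ, 1 < b ∧
        (fun n => Compound.gradVar (Compound.basisState (S n)) (O n) (H n)) =O[atTop]
          fun n : ℕ => 1 / b ^ n) := by
  -- Qubits `1` and `2` are the indices `0` and `1` of `Fin n`.
  have h01 : ∀ (n : ℕ) (hn : 2 ≤ n), (⟨0, by omega⟩ : Fin n) < ⟨1, by omega⟩ :=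
    fun n hn => Fin.mk_lt_mk.2 one_pos
  refine ⟨fun n hn => ⟨Compound.dla_generators n, Compound.isLASA_hz (h01 n hn)⟩,
    fun n hn o ho h hh O H hO hH S => Compound.gradVar_eq hn ho hh hO hH S,
    fun n hn H hH S => Compound.gradVar_hz_eq hn (h01 n hn) hH S,
    ⟨1 / 4, by norm_num, fun n hn H hH S hS hS' =>
      Compound.le_gradVar_hz hn (h01 n hn) hH hS hS'⟩, ?_, ?_⟩
  · intro o h O H S δ hδ hyp
    refine Compound.no_barren_plateau (pow_pos hδ 2) fun n hn => ?_
    obtain ⟨ho, hh, hO, hH, hδo, hδh, hS, hS'⟩ := hyp n hn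
    exact Compound.le_gradVar hn ho hh hO hH hS hS' hδ hδo hδh
  · intro O H S hyp
    refine Compound.no_barren_plateau (c := 1 / 4) (by norm_num) fun n hn => ?_
    obtain ⟨hO, hH, hS, hS'⟩ := hyp n hn
    rw [hO]
    exact Compound.le_gradVar_hz hn (h01 n hn) hH hS hS'
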